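/- Let $H$ be a finite-dimensional Hopf algebra over $\mathbf{C}$ with comultiplication $\Delta$ and counit $\varepsilon$, written $\Delta(a)=\sum a_1\otimes a_2$. Suppose that $H$ is pointed, i.e. every simple $H$-comodule is $1$-dimensional, and cotriangular, i.e. there is a bilinear form $r:H\times H\to\mathbf{C}$ such that for all $a,b,c\in H$ $$r(ab,c)=\sum r(a,c_1)\,r(b,c_2),\qquad r(a,bc)=\sum r(a_1,c)\,r(a_2,b),$$ $$\sum r(a_1,b_1)\,a_2b_2=\sum r(a_2,b_2)\,b_1a_1,\qquad \sum r(a_1,b_1)\,r(b_2,a_2)=\varepsilon(a)\varepsilon(b).$$ Then $H$ is generated, as an algebra, by its grouplike elements (those $g$ with $\Delta(g)=g\otimes g$ and $\varepsilon(g)=1$) and its skew-primitive elements (those $x$ with $\Delta(x)=x\otimes g+h\otimes x$ for some grouplike $g,h$). -/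

import Mathlib

open scoped TensorProduct

universe u v

section Comodules

/-- A right comodule structure on a `k`-module `V` over a `k`-coalgebra `C`: a coassociative and
counital `k`-linear map `ρ : V → V ⊗ C`. -/
structure RightComodule (k : Type u) (C V : Type v) [CommRing k] [AddCommGroup C] [Module k C]
    [Coalgebra k C] [AddCommGroup V] [Module k V] where
  /-- The coaction `ρ`. -/
  coact : V →ₗ[k] V ⊗[k] C
  /-- `(ρ ⊗ id) ∘ ρ = (id ⊗ Δ) ∘ ρ`. -/
  coassoc : (TensorProduct.assoc k V C C).toLinearMap ∘ₗ coact.rTensor C ∘ₗ coact =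
    (Coalgebra.comul (R := k) (A := C)).lTensor V ∘ₗ coact
  /-- `(id ⊗ ε) ∘ ρ = id`, where `V ⊗ k` is identified with `V`. -/
  counital : (TensorProduct.rid k V).toLinearMap ∘ₗ
    (Coalgebra.counit (R := k) (A := C)).lTensor V ∘ₗ coact = LinearMap.id

variable {k : Type u} {C V : Type v} [Field k] [AddCommGroup C] [Module k C]
  [Coalgebra k C] [AddCommGroup V] [Module k V]

/-- A subspace `W` of a right comodule `V` is a subcomodule if `ρ(W) ⊆ W ⊗ C`. -/
def RightComodule.IsSubcomodule (M : RightComodule k C V) (W : Submodule k V) : Prop :=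
  ∀ w ∈ W, M.coact w ∈ LinearMap.range (W.subtype.rTensor C)

/-- A right comodule is simple if it is nonzero and has no subcomodules other than `0` and
itself. -/
def RightComodule.IsSimple (M : RightComodule k C V) : Prop :=
  Nontrivial V ∧ ∀ W : Submodule k V, M.IsSubcomodule W → W = ⊥ ∨ W = ⊤

/-- A coalgebra over a field is pointed if all of its simple right comodules are one-dimensional.
(Every simple comodule embeds into the coalgebra, so the comodules in the universe of `C`
suffice.) -/
def IsPointedCoalgebra (k : Type u) (C : Type v) [Field k] [AddCommGroup C] [Module k C]
    [Coalgebra k C] : Prop :=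
  ∀ (V : Type v) [AddCommGroup V] [Module k V] (M : RightComodule k C V),
    M.IsSimple → Module.finrank k V = 1

end Comodules

section Hopf

variable {k : Type u} {H : Type v} [Field k] [Ring H]

/-- A cotriangular structure on a Hopf algebra `H`: a bilinear form `r` on `H` such that,
in Sweedler notation,
* `r(ab, c) = ∑ r(a, c₁) r(b, c₂)`,
* `r(a, bc) = ∑ r(a₁, c) r(a₂, b)`,
* `∑ r(a₁, b₁) a₂ b₂ = ∑ r(a₂, b₂) b₁ a₁`,
* `∑ r(a₁, b₁) r(b₂, a₂) = ε(a) ε(b)`, that is, `r` is convolution invertible with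
  inverse `(a, b) ↦ r(b, a)`.

Here `Coalgebra.comul (a ⊗ b) = ∑ (a₁ ⊗ b₁) ⊗ (a₂ ⊗ b₂)` is the comultiplication of `H ⊗ H`. -/
structure IsCotriangularForm [HopfAlgebra k H] (r : H →ₗ[k] H →ₗ[k] k) : Prop where
  mul_left (a b c : H) : r (a * b) c =
    LinearMap.mul' k k (TensorProduct.map (r a) (r b) (Coalgebra.comul (R := k) c))
  mul_right (a b c : H) : r a (b * c) =
    LinearMap.mul' k k (TensorProduct.map (r.flip c) (r.flip b) (Coalgebra.comul (R := k) a))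
  commutation (a b : H) :
    TensorProduct.lid k H (TensorProduct.map (TensorProduct.lift r) (LinearMap.mul' k H)
        (Coalgebra.comul (R := k) (a ⊗ₜ[k] b))) =
      TensorProduct.rid k H (TensorProduct.map
        (LinearMap.mul' k H ∘ₗ (TensorProduct.comm k H H).toLinearMap) (TensorProduct.lift r)
        (Coalgebra.comul (R := k) (a ⊗ₜ[k] b)))
  inverse (a b : H) :
    LinearMap.mul' k k (TensorProduct.map (TensorProduct.lift r) (TensorProduct.lift r.flip)
        (Coalgebra.comul (R := k) (a ⊗ₜ[k] b))) =
      Coalgebra.counit (R := k) a * Coalgebra.counit (R := k) b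

/-- A Hopf algebra is cotriangular if it carries a cotriangular structure. -/
def IsCotriangular (k : Type u) (H : Type v) [Field k] [Ring H] [HopfAlgebra k H] : Prop :=
  ∃ r : H →ₗ[k] H →ₗ[k] k, IsCotriangularForm r

/-- An element `x` is skew-primitive if `Δ(x) = x ⊗ g + h ⊗ x` for some grouplike elements
`g` and `h`. -/
def IsSkewPrimitiveElem (k : Type u) {H : Type v} [Field k] [Ring H] [HopfAlgebra k H]
    (x : H) : Prop :=
  ∃ g h : H, IsGroupLikeElem k g ∧ IsGroupLikeElem k h ∧
    Coalgebra.comul (R := k) x = x ⊗ₜ[k] g + h ⊗ₜ[k] x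

end Hopf

/-!
# Finite-dimensional pointed cotriangular Hopf algebras are generated in degree one

Let `H₀ ⊆ H₁ ⊆ ⋯` be the coradical filtration of `H`; as `H` is pointed, `H₀` is spanned by the
grouplike elements and the filtration is exhaustive (`PointedHopf.exists_corad_eq_top`). In the
code `Hₙ` is `corad k H (n + 1)`, so that `corad k H 0 = 0` can play the role of `H₋₁`. A
functional `f` acts on `H` by `f ⇀ a = ∑ a₁ f(a₂)`, and a functional killing `H_{m-1}` lowers the
filtration by `m`.

Modulo `H₀`, the space `H₁` is spanned by elements `h xᵢ` with `h` grouplike and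
`Δ(xᵢ) = xᵢ ⊗ 1 + gᵢ ⊗ xᵢ`, and there are functionals `fᵢ` killing `H₀` with `fᵢ(h xⱼ) = δᵢⱼ`
(`PointedHopf.exists_skewFrame`). The cotriangular form makes the grouplike elements an abelian
group with a bicharacter satisfying `r(g, h) r(h, g) = 1`, and it makes an element of left degree
`g` and right degree `1` commute with a grouplike element `h` up to the scalar `r(g, h)` and lower
order terms (`PointedHopf.groupLike_mul_sub_mem`). Hence the grouplike elements have a parity
`r(g, g) = ±1`.

The heart of the matter is that there are no even generators
(`PointedHopf.false_of_even_generator`): if `y` has even degree `g`, is primitive up to lower order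
terms, and is detected by a functional `z` killing all products of lower order elements, then
`z ⇀ ·` behaves like a derivation with `z ⇀ yⁿ⁺¹ = (n + 1) yⁿ g + ⋯`, so in characteristic zero the
powers of `y` contradict finite-dimensionality. Applied to `H₁` this shows that all `gᵢ` are odd.
The braided commutator of `fᵢ` and `fⱼ` kills all products `H₁ H₁` and is homogeneous of degree
`gᵢ gⱼ`, which is then even; so, applied to `H₂`, the same lemma shows that this commutator kills
`H₂` (`PointedHopf.SkewFrame.commutator_eq_zero`).

Thus the operators `fᵢ ⇀ ·` satisfy, up to lower order terms, the relations of partial derivatives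
on a braided exterior algebra, and the Euler operator `a ↦ ∑ᵢ (fᵢ ⇀ a) gᵢ⁻¹ xᵢ` acts on
`Hₙ / Hₙ₋₁` as multiplication by `n` (`PointedHopf.SkewFrame.euler_sub_smul_mem`). It therefore
expresses every element of `Hₙ`, for `n ≥ 1`, through elements of `Hₙ₋₁` and the `xᵢ`.
-/

open Coalgebra Module

namespace PointedHopf

/-! ### Slicing tensors and the action of functionals -/

section Coalg

variable {k : Type u} {C : Type v} [Field k] [AddCommGroup C] [Module k C]

/-- Slicing the right leg of a tensor by a functional: `u ⊗ v ↦ f(v) u`. -/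
noncomputable def sliceR (f : Dual k C) : C ⊗[k] C →ₗ[k] C :=
  (TensorProduct.rid k C).toLinearMap ∘ₗ f.lTensor C

/-- Slicing the left leg of a tensor by a functional: `u ⊗ v ↦ f(u) v`. -/
noncomputable def sliceL (f : Dual k C) : C ⊗[k] C →ₗ[k] C :=
  (TensorProduct.lid k C).toLinearMap ∘ₗ f.rTensor C

@[simp] lemma sliceR_tmul (f : Dual k C) (a b : C) : sliceR f (a ⊗ₜ[k] b) = f b • a := by
  simp [sliceR]

@[simp] lemma sliceL_tmul (f : Dual k C) (a b : C) : sliceL f (a ⊗ₜ[k] b) = f a • b := by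
  simp [sliceL]

lemma sliceR_add (f g : Dual k C) (t : C ⊗[k] C) :
    sliceR (f + g) t = sliceR f t + sliceR g t := by
  simp [sliceR, LinearMap.lTensor_add]

lemma sliceR_smul (c : k) (f : Dual k C) (t : C ⊗[k] C) :
    sliceR (c • f) t = c • sliceR f t := by
  simp [sliceR, LinearMap.lTensor_smul]

lemma sliceL_add (f g : Dual k C) (t : C ⊗[k] C) :
    sliceL (f + g) t = sliceL f t + sliceL g t := by
  simp [sliceL, LinearMap.rTensor_add]

lemma sliceL_smul (c : k) (f : Dual k C) (t : C ⊗[k] C) :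
    sliceL (c • f) t = c • sliceL f t := by
  simp [sliceL, LinearMap.rTensor_smul]

lemma apply_sliceR (f g : Dual k C) (t : C ⊗[k] C) : f (sliceR g t) = g (sliceL f t) := by
  induction t with
  | zero => simp
  | tmul a b => simp [mul_comm]
  | add s t hs ht => simp [hs, ht]

lemma sliceR_lTensor (f : Dual k C) (p : C →ₗ[k] C) (t : C ⊗[k] C) :
    sliceR f (p.lTensor C t) = sliceR (f ∘ₗ p) t := by
  simp [sliceR, LinearMap.lTensor_comp]

lemma sliceL_lTensor (f : Dual k C) (p : C →ₗ[k] C) (t : C ⊗[k] C) :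
    sliceL f (p.lTensor C t) = p (sliceL f t) := by
  induction t with
  | zero => simp
  | tmul a b => simp
  | add s t hs ht => simp [hs, ht]

lemma sum_sliceR_tmul [FiniteDimensional k C] (t : C ⊗[k] C) :
    ∑ i, sliceR ((finBasis k C).coord i) t ⊗ₜ[k] finBasis k C i = t := by
  induction t with
  | zero => simp
  | tmul a b =>
    simp_rw [sliceR_tmul, TensorProduct.smul_tmul, ← TensorProduct.tmul_sum]
    congr 1
    exact (finBasis k C).sum_repr b
  | add s t hs ht =>
    simp_rw [map_add, TensorProduct.add_tmul, Finset.sum_add_distrib, hs, ht]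

lemma eq_of_sliceR_eq [FiniteDimensional k C] {s t : C ⊗[k] C}
    (h : ∀ f : Dual k C, sliceR f s = sliceR f t) : s = t := by
  rw [← sum_sliceR_tmul s, ← sum_sliceR_tmul t]
  simp_rw [h]

lemma eq_of_sliceL_eq [FiniteDimensional k C] {s t : C ⊗[k] C}
    (h : ∀ f : Dual k C, sliceL f s = sliceL f t) : s = t := by
  refine eq_of_sliceR_eq fun f => ?_
  refine (Module.forall_dual_apply_eq_zero_iff k _).1 (fun g => ?_) |> sub_eq_zero.1
  rw [map_sub, apply_sliceR, apply_sliceR, h, sub_self]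

/-- The image of `U ⊗ W` in `C ⊗ C`. -/
noncomputable abbrev tensorSub (U W : Submodule k C) : Submodule k (C ⊗[k] C) :=
  Submodule.map₂ (TensorProduct.mk k C C) U W

lemma tmul_mem_tensorSub {U W : Submodule k C} {a b : C} (ha : a ∈ U) (hb : b ∈ W) :
    a ⊗ₜ[k] b ∈ tensorSub U W :=
  Submodule.apply_mem_map₂ _ ha hb

lemma tensorSub_induction {U W : Submodule k C} {p : C ⊗[k] C → Prop} {t : C ⊗[k] C}
    (ht : t ∈ tensorSub U W) (tmul : ∀ a ∈ U, ∀ b ∈ W, p (a ⊗ₜ b))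
    (zero : p 0) (add : ∀ s t, p s → p t → p (s + t)) : p t := by
  rw [tensorSub, Submodule.map₂_eq_span_image2] at ht
  have key : ∀ t ∈ Submodule.span k
      (Set.image2 (fun a b => TensorProduct.mk k C C a b) (U : Set C) W), ∀ c : k, p (c • t) := by
    intro t ht
    induction ht using Submodule.span_induction with
    | mem x hx =>
      obtain ⟨a, ha, b, hb, rfl⟩ := hx
      intro c
      simpa [TensorProduct.smul_tmul'] using tmul _ (U.smul_mem c ha) _ hb
    | zero => simpa using zero
    | add s t _ _ hs ht => intro c; rw [smul_add]; exact add _ _ (hs c) (ht c)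
    | smul d t _ ht => intro c; rw [smul_smul]; exact ht _
  simpa using key t ht 1

lemma exists_projection (W : Submodule k C) :
    ∃ p : C →ₗ[k] C, (∀ a, p a ∈ W) ∧ ∀ a ∈ W, p a = a := by
  obtain ⟨q, hq⟩ := W.subtype.exists_leftInverse_of_injective W.ker_subtype
  refine ⟨W.subtype ∘ₗ q, fun a => (q a).2, fun a ha => ?_⟩
  have := LinearMap.congr_fun hq ⟨a, ha⟩
  simpa using congrArg Subtype.val this

lemma mem_tensorSub_top [FiniteDimensional k C] {U : Submodule k C} {t : C ⊗[k] C}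
    (h : ∀ f : Dual k C, sliceR f t ∈ U) : t ∈ tensorSub U ⊤ := by
  rw [← sum_sliceR_tmul t]
  exact Submodule.sum_mem _ fun i _ => tmul_mem_tensorSub (h _) trivial

lemma mem_tensorSub [FiniteDimensional k C] {U W : Submodule k C} {t : C ⊗[k] C}
    (hR : ∀ f : Dual k C, sliceR f t ∈ U) (hL : ∀ f : Dual k C, sliceL f t ∈ W) :
    t ∈ tensorSub U W := by
  obtain ⟨p, hp, hpW⟩ := exists_projection W
  have ht : p.lTensor C t = t :=
    eq_of_sliceL_eq fun f => by rw [sliceL_lTensor, hpW _ (hL f)]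
  rw [← ht, ← sum_sliceR_tmul t, map_sum]
  exact Submodule.sum_mem _ fun i _ => by
    rw [LinearMap.lTensor_tmul]
    exact tmul_mem_tensorSub (hR _) (hp _)

variable [Coalgebra k C]

/-- The left action `f ⇀ a = ∑ a₁ f(a₂)` of the dual algebra on a coalgebra. -/
noncomputable def hitR (f : Dual k C) : C →ₗ[k] C := sliceR f ∘ₗ comul

/-- The right action `a ↼ f = ∑ f(a₁) a₂` of the dual algebra on a coalgebra. -/
noncomputable def hitL (f : Dual k C) : C →ₗ[k] C := sliceL f ∘ₗ comul

lemma hitR_apply (f : Dual k C) (a : C) : hitR f a = sliceR f (comul a) := rfl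

lemma hitL_apply (f : Dual k C) (a : C) : hitL f a = sliceL f (comul a) := rfl

lemma hitR_add (f g : Dual k C) (a : C) : hitR (f + g) a = hitR f a + hitR g a :=
  sliceR_add f g _

lemma hitR_smul (c : k) (f : Dual k C) (a : C) : hitR (c • f) a = c • hitR f a :=
  sliceR_smul c f _

lemma hitL_add (f g : Dual k C) (a : C) : hitL (f + g) a = hitL f a + hitL g a :=
  sliceL_add f g _

lemma hitL_smul (c : k) (f : Dual k C) (a : C) : hitL (c • f) a = c • hitL f a :=
  sliceL_smul c f _

lemma hitR_sub (f g : Dual k C) (a : C) : hitR (f - g) a = hitR f a - hitR g a := by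
  have := hitR_add (f - g) g a
  rw [sub_add_cancel] at this
  rw [this, add_sub_cancel_right]

lemma hitL_sub (f g : Dual k C) (a : C) : hitL (f - g) a = hitL f a - hitL g a := by
  have := hitL_add (f - g) g a
  rw [sub_add_cancel] at this
  rw [this, add_sub_cancel_right]

lemma hitR_zero (a : C) : hitR (0 : Dual k C) a = 0 := by
  simpa using hitR_smul (0 : k) (0 : Dual k C) a

lemma hitL_zero (a : C) : hitL (0 : Dual k C) a = 0 := by
  simpa using hitL_smul (0 : k) (0 : Dual k C) a

lemma hitR_sum {ι : Type*} (s : Finset ι) (f : ι → Dual k C) (a : C) :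
    hitR (∑ i ∈ s, f i) a = ∑ i ∈ s, hitR (f i) a := by
  classical
  induction s using Finset.induction_on with
  | empty => simpa using hitR_zero a
  | insert i s hi ih => rw [Finset.sum_insert hi, Finset.sum_insert hi, hitR_add, ih]

lemma hitL_sum {ι : Type*} (s : Finset ι) (f : ι → Dual k C) (a : C) :
    hitL (∑ i ∈ s, f i) a = ∑ i ∈ s, hitL (f i) a := by
  classical
  induction s using Finset.induction_on with
  | empty => simpa using hitL_zero a
  | insert i s hi ih => rw [Finset.sum_insert hi, Finset.sum_insert hi, hitL_add, ih]

@[simp] lemma hitR_counit (a : C) : hitR (counit (R := k)) a = a := by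
  rw [hitR_apply, sliceR, LinearMap.comp_apply, lTensor_counit_comul]; simp

@[simp] lemma hitL_counit (a : C) : hitL (counit (R := k)) a = a := by
  rw [hitL_apply, sliceL, LinearMap.comp_apply, rTensor_counit_comul]; simp

lemma apply_hitR (f g : Dual k C) (a : C) : f (hitR g a) = g (hitL f a) := apply_sliceR f g _

@[simp] lemma counit_hitR (f : Dual k C) (a : C) : counit (R := k) (hitR f a) = f a := by
  rw [apply_hitR, hitL_counit]

lemma hitR_hitR (f g : Dual k C) (a : C) : hitR f (hitR g a) = hitR (f ∘ₗ hitR g) a := by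
  let M : C ⊗[k] (C ⊗[k] C) →ₗ[k] C :=
    (TensorProduct.rid k C).toLinearMap ∘ₗ (f ∘ₗ sliceR g).lTensor C
  have h1 : ∀ t : C ⊗[k] C, M (TensorProduct.assoc k C C C (comul.rTensor C t)) =
      hitR f (sliceR g t) := by
    intro t
    induction t with
    | zero => simp
    | tmul a b =>
      rw [LinearMap.rTensor_tmul, sliceR_tmul, map_smul, hitR_apply]
      induction comul (R := k) a with
      | zero => simp
      | tmul c d => simp [M, smul_smul]
      | add s t hs ht => simp only [TensorProduct.add_tmul, map_add, smul_add, hs, ht]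
    | add s t hs ht => simp only [map_add, hs, ht]
  have h2 : ∀ t : C ⊗[k] C, M (comul.lTensor C t) = sliceR (f ∘ₗ hitR g) t := by
    intro t
    induction t with
    | zero => simp
    | tmul a b => simp [M, hitR_apply]
    | add s t hs ht => simp only [map_add, hs, ht]
  rw [hitR_apply g, ← h1, coassoc_apply, h2, hitR_apply]

/-- Applying an operator `f ⇀ ·` commutes with the comultiplication in the right leg. -/
lemma comul_hitR (f : Dual k C) (a : C) :
    comul (R := k) (hitR f a) = (hitR f).lTensor C (comul a) := by
  let M : C ⊗[k] (C ⊗[k] C) →ₗ[k] C ⊗[k] C := (sliceR f).lTensor C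
  have h1 : ∀ t : C ⊗[k] C, M (TensorProduct.assoc k C C C (comul.rTensor C t)) =
      comul (sliceR f t) := by
    intro t
    induction t with
    | zero => simp
    | tmul a b =>
      rw [LinearMap.rTensor_tmul, sliceR_tmul, map_smul]
      induction comul (R := k) a with
      | zero => simp
      | tmul c d => simp [M]
      | add s t hs ht => simp only [TensorProduct.add_tmul, map_add, smul_add, hs, ht]
    | add s t hs ht => simp only [map_add, hs, ht]
  rw [hitR_apply, ← h1, coassoc_apply, hitR, LinearMap.lTensor_comp]
  rfl

lemma hitL_hitR (f g : Dual k C) (a : C) : hitL f (hitR g a) = hitR g (hitL f a) := by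
  rw [hitL_apply, comul_hitR, sliceL_lTensor]
  rfl

lemma hitL_hitL (f g : Dual k C) (a : C) :
    hitL f (hitL g a) = hitL (g ∘ₗ hitR f) a := by
  refine (Module.forall_dual_apply_eq_zero_iff k _).1 (fun φ => ?_) |> sub_eq_zero.1
  rw [map_sub, ← apply_hitR, ← hitL_hitR, ← apply_hitR, ← apply_hitR, LinearMap.comp_apply,
    sub_self]

@[simp] lemma counit_hitL (f : Dual k C) (a : C) : counit (R := k) (hitL f a) = f a := by
  rw [← apply_hitR, hitR_counit]

lemma hitR_of_comul_eq {f : Dual k C} {a x y g h : C} (ha : comul (R := k) a = x ⊗ₜ g + h ⊗ₜ y) :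
    hitR f a = f g • x + f y • h := by
  rw [hitR_apply, ha, map_add, sliceR_tmul, sliceR_tmul]

lemma hitL_of_comul_eq {f : Dual k C} {a x y g h : C} (ha : comul (R := k) a = x ⊗ₜ g + h ⊗ₜ y) :
    hitL f a = f x • g + f h • y := by
  rw [hitL_apply, ha, map_add, sliceL_tmul, sliceL_tmul]

end Coalg

/-! ### The coradical filtration -/

section Filtration

variable {k : Type u} {C : Type v} [Field k] [AddCommGroup C] [Module k C] [Coalgebra k C]

@[simp] lemma hitR_groupLike (f : Dual k C) (g : GroupLike k C) :
    hitR f (g : C) = f g • (g : C) := by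
  rw [hitR_apply, g.2.comul_eq_tmul_self, sliceR_tmul]

@[simp] lemma hitL_groupLike (f : Dual k C) (g : GroupLike k C) :
    hitL f (g : C) = f g • (g : C) := by
  rw [hitL_apply, g.2.comul_eq_tmul_self, sliceL_tmul]

variable (k C) in
/-- The span of the grouplike elements; this is the coradical when `C` is pointed. -/
def grouplikeSpan : Submodule k C := Submodule.span k (Set.range (GroupLike.val (R := k) (A := C)))

lemma groupLike_mem (g : GroupLike k C) : (g : C) ∈ grouplikeSpan k C :=
  Submodule.subset_span ⟨g, rfl⟩

variable (k C) in
/-- The functionals vanishing on all grouplike elements. -/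
def augJ : Submodule k (Dual k C) := (grouplikeSpan k C).dualAnnihilator

lemma mem_augJ {f : Dual k C} : f ∈ augJ k C ↔ ∀ g : GroupLike k C, f g = 0 := by
  rw [augJ, Submodule.mem_dualAnnihilator]
  refine ⟨fun h g => h _ (groupLike_mem g), fun h a ha => ?_⟩
  induction ha using Submodule.span_induction with
  | mem x hx => obtain ⟨g, rfl⟩ := hx; exact h g
  | zero => simp
  | add x y _ _ hx hy => simp [hx, hy]
  | smul c x _ hx => simp [hx]

lemma apply_eq_zero_of_mem_augJ {f : Dual k C} (hf : f ∈ augJ k C) {a : C}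
    (ha : a ∈ grouplikeSpan k C) : f a = 0 :=
  (Submodule.mem_dualAnnihilator f).1 hf a ha

lemma mem_grouplikeSpan_of_forall {a : C} (h : ∀ f ∈ augJ k C, f a = 0) :
    a ∈ grouplikeSpan k C := by
  rw [← Subspace.dualAnnihilator_dualCoannihilator_eq (W := grouplikeSpan k C)]
  exact (Submodule.mem_dualCoannihilator a).2 h

lemma comp_hitR_mem_augJ {f : Dual k C} (hf : f ∈ augJ k C) (g : Dual k C) :
    f ∘ₗ hitR g ∈ augJ k C :=
  mem_augJ.2 fun x => by simp [mem_augJ.1 hf x]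

variable (k C) in
/-- The coradical filtration, indexed so that `corad k C (n + 1)` is its `n`-th term `C_n` and
`corad k C 0 = 0`: an element lies in `C_n` when every functional killing the grouplikes moves it
to `C_{n-1}`. Here `C_0` is the span of the grouplikes, so that this is the usual coradical
filtration only for pointed `C`. -/
def corad : ℕ → Submodule k C
  | 0 => ⊥
  | n + 1 =>
    { carrier := {a | ∀ f ∈ augJ k C, hitR f a ∈ corad n}
      add_mem' := fun ha hb f hf => by
        rw [map_add]; exact Submodule.add_mem _ (ha f hf) (hb f hf)
      zero_mem' := fun f _ => by rw [map_zero]; exact Submodule.zero_mem _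
      smul_mem' := fun c a ha f hf => by
        rw [map_smul]; exact Submodule.smul_mem _ c (ha f hf) }

@[simp] lemma mem_corad_zero {a : C} : a ∈ corad k C 0 ↔ a = 0 := Iff.rfl

lemma corad_one : corad k C 1 = grouplikeSpan k C := by
  apply le_antisymm
  · refine fun a ha => mem_grouplikeSpan_of_forall fun f hf => ?_
    rw [← counit_hitR, mem_corad_zero.1 (ha f hf), map_zero]
  · refine Submodule.span_le.2 ?_
    rintro _ ⟨g, rfl⟩ f hf
    simp [mem_augJ.1 hf g]

lemma hitR_mem_corad (f : Dual k C) {n : ℕ} {a : C} (ha : a ∈ corad k C n) :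
    hitR f a ∈ corad k C n := by
  cases n with
  | zero => simp_all
  | succ n =>
    intro φ hφ
    rw [hitR_hitR]
    exact ha _ (comp_hitR_mem_augJ hφ f)

lemma hitL_mem_corad (f : Dual k C) {n : ℕ} {a : C} (ha : a ∈ corad k C n) :
    hitL f a ∈ corad k C n := by
  induction n generalizing a with
  | zero => simp_all
  | succ n ih =>
    intro φ hφ
    rw [← hitL_hitR]
    exact ih (ha φ hφ)

lemma corad_mono : Monotone (corad k C) :=
  monotone_nat_of_le_succ fun _ _ ha f _ => hitR_mem_corad f ha

lemma groupLike_mem_corad (g : GroupLike k C) (n : ℕ) : (g : C) ∈ corad k C (n + 1) :=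
  corad_mono (Nat.le_add_left 1 n) (corad_one (k := k) (C := C) ▸ groupLike_mem g)

/-- The coradical filtration may as well be defined by slicing on the left. -/
lemma mem_corad_succ_iff_hitL {n : ℕ} {a : C} :
    a ∈ corad k C (n + 1) ↔ ∀ f ∈ augJ k C, hitL f a ∈ corad k C n := by
  refine ⟨fun ha f hf => ?_, fun ha => ?_⟩
  · induction n generalizing a with
    | zero =>
      rw [zero_add, corad_one] at ha
      induction ha using Submodule.span_induction with
      | mem x hx => obtain ⟨g, rfl⟩ := hx; simp [mem_augJ.1 hf g]
      | zero => simp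
      | add x y _ _ hx hy => rw [map_add]; exact Submodule.add_mem _ hx hy
      | smul c x _ hx => rw [map_smul]; exact Submodule.smul_mem _ c hx
    | succ n ih =>
      intro φ hφ
      rw [← hitL_hitR]
      exact ih (ha φ hφ)
  · induction n generalizing a with
    | zero =>
      rw [zero_add, corad_one]
      refine mem_grouplikeSpan_of_forall fun f hf => ?_
      rw [← counit_hitL, mem_corad_zero.1 (ha f hf), map_zero]
    | succ n ih =>
      refine fun f hf => ih fun φ hφ => ?_
      rw [hitL_hitR]
      exact ha φ hφ f hf

/-- A functional vanishing on the `m`-th step of the filtration lowers the filtration by `m`. -/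
lemma hitR_mem_corad_sub {z : Dual k C} {m n : ℕ} (hz : ∀ a ∈ corad k C m, z a = 0) {a : C}
    (ha : a ∈ corad k C n) : hitR z a ∈ corad k C (n - m) := by
  have base : ∀ b ∈ corad k C m, hitR z b = 0 := by
    intro b hb
    refine (Module.forall_dual_apply_eq_zero_iff k _).1 fun φ => ?_
    rw [apply_hitR]
    exact hz _ (hitL_mem_corad φ hb)
  have step : ∀ d : ℕ, ∀ b ∈ corad k C (d + m), hitR z b ∈ corad k C d := by
    intro d
    induction d with
    | zero => intro b hb; rw [zero_add] at hb; exact base b hb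
    | succ d ih =>
      intro b hb
      rw [mem_corad_succ_iff_hitL]
      intro f hf
      rw [hitL_hitR]
      rw [add_right_comm, mem_corad_succ_iff_hitL] at hb
      exact ih _ (hb f hf)
  exact step _ _ (corad_mono (by omega) ha)

/-- Any function on the grouplike elements extends to a functional. -/
lemma exists_dual_groupLike (φ : GroupLike k C → k) :
    ∃ f : Dual k C, ∀ g : GroupLike k C, f g = φ g := by
  have hli := linearIndep_groupLikeVal (R := k) (A := C)
  obtain ⟨q, hq⟩ := LinearMap.exists_leftInverse_of_injective _
    (LinearMap.ker_eq_bot.2 hli)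
  refine ⟨Finsupp.linearCombination k φ ∘ₗ q, fun g => ?_⟩
  have := LinearMap.congr_fun hq (Finsupp.single g 1)
  simp at this
  simp [this]

open Classical in
/-- A functional dual to the grouplike element `g`: it is `1` at `g` and `0` at the others. -/
noncomputable def dualAt (g : GroupLike k C) : Dual k C :=
  (exists_dual_groupLike (Pi.single g (1 : k))).choose

open Classical in
lemma dualAt_apply (g h : GroupLike k C) : dualAt g (h : C) = if h = g then (1 : k) else 0 := by
  rw [dualAt, (exists_dual_groupLike (Pi.single g (1 : k))).choose_spec h, Pi.single_apply]

@[simp] lemma dualAt_self (g : GroupLike k C) : dualAt g (g : C) = (1 : k) := by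
  rw [dualAt_apply, if_pos rfl]

/-- The component of `a` of left degree `h` and right degree `g`. -/
noncomputable def component (h g : GroupLike k C) : C →ₗ[k] C := hitL (dualAt h) ∘ₗ hitR (dualAt g)

lemma component_mem_corad (h g : GroupLike k C) {n : ℕ} {a : C} (ha : a ∈ corad k C n) :
    component h g a ∈ corad k C n :=
  hitL_mem_corad _ (hitR_mem_corad _ ha)

lemma sub_sum_component_mem [Fintype (GroupLike k C)] {n : ℕ} {a : C}
    (ha : a ∈ corad k C (n + 1)) :
    a - ∑ h : GroupLike k C, ∑ g : GroupLike k C, component h g a ∈ corad k C n := by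
  classical
  set e : Dual k C := ∑ g : GroupLike k C, dualAt g with he
  have hJ : counit - e ∈ augJ k C := mem_augJ.2 fun x => by
    simp [he, dualAt_apply, LinearMap.sum_apply]
  have h1 : ∑ h : GroupLike k C, ∑ g : GroupLike k C, component h g a = hitL e (hitR e a) := by
    rw [he, hitL_sum, hitR_sum]
    simp [component]
  have h2 := ha _ hJ
  have h3 := mem_corad_succ_iff_hitL.1 (hitR_mem_corad e ha) _ hJ
  rw [hitR_sub, hitR_counit] at h2
  rw [hitL_sub, hitL_counit] at h3
  rw [h1]
  simpa using Submodule.add_mem _ h2 h3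

variable [FiniteDimensional k C]

instance finite_groupLike : Finite (GroupLike k C) :=
  (linearIndep_groupLikeVal (R := k) (A := C)).finite

lemma comul_mem_tensorSub {n : ℕ} {a : C} (ha : a ∈ corad k C (n + 1)) :
    comul (R := k) a ∈ tensorSub (corad k C (n + 1)) (grouplikeSpan k C) ⊔
      tensorSub (corad k C n) ⊤ := by
  obtain ⟨p, hp, hpid⟩ := exists_projection (grouplikeSpan k C)
  have ht : comul (R := k) a =
      p.lTensor C (comul a) + (LinearMap.id - p).lTensor C (comul (R := k) a) := by
    rw [← LinearMap.add_apply, ← LinearMap.lTensor_add]; simp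
  rw [ht]
  refine Submodule.add_mem_sup ?_ (mem_tensorSub_top fun f => ?_)
  · refine mem_tensorSub (fun f => ?_) (fun f => ?_)
    · rw [sliceR_lTensor]; exact hitR_mem_corad _ ha
    · rw [sliceL_lTensor]; exact hp _
  · rw [sliceR_lTensor]
    exact ha _ (mem_augJ.2 fun g => by simp [hpid _ (groupLike_mem g)])

/-- A component of an element of `C_n` is primitive of its bidegree up to `C_{n-1} ⊗ C_{n-1}`. -/
lemma comul_component (h g : GroupLike k C) {n : ℕ} {a : C} (ha : a ∈ corad k C (n + 2)) :
    comul (R := k) (component h g a) - component h g a ⊗ₜ[k] (g : C) -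
      (h : C) ⊗ₜ[k] component h g a ∈ tensorSub (corad k C (n + 1)) (corad k C (n + 1)) := by
  classical
  refine mem_tensorSub (fun f => ?_) (fun f => ?_)
  · have h1 : f ∘ₗ hitR (dualAt g) - f g • dualAt g ∈ augJ k C := by
      refine mem_augJ.2 fun x => ?_
      by_cases hx : x = g
      · simp [hx]
      · simp [dualAt_apply, hx]
    have h2 := hitL_mem_corad (dualAt h) (ha _ h1)
    rw [map_sub, map_sub, sliceR_tmul, sliceR_tmul, ← hitR_apply]
    refine Submodule.sub_mem _ ?_ (Submodule.smul_mem _ _ (groupLike_mem_corad h n))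
    rw [hitR_sub, hitR_smul, map_sub, map_smul, ← hitR_hitR, hitL_hitR] at h2
    exact h2
  · have h1 : dualAt h ∘ₗ hitR f - f h • dualAt h ∈ augJ k C := by
      refine mem_augJ.2 fun x => ?_
      by_cases hx : x = h
      · simp [hx]
      · simp [dualAt_apply, hx]
    have h2 := mem_corad_succ_iff_hitL.1 (hitR_mem_corad (dualAt g) ha) _ h1
    rw [map_sub, map_sub, sliceL_tmul, sliceL_tmul, ← hitL_apply, sub_right_comm]
    refine Submodule.sub_mem _ ?_ (Submodule.smul_mem _ _ (groupLike_mem_corad g n))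
    rw [hitL_sub, hitL_smul, ← hitL_hitL] at h2
    simpa [component] using h2

/-- The first step of the Taft–Wilson theorem: the bihomogeneous components of elements of `C_1`
become skew-primitive after subtracting a combination of grouplike elements. -/
lemma exists_skewPrimitive (h g : GroupLike k C) {a : C} (ha : a ∈ corad k C 2) :
    ∃ x : C, component h g a - x ∈ grouplikeSpan k C ∧
      comul (R := k) x = x ⊗ₜ[k] (g : C) + (h : C) ⊗ₜ[k] x := by
  classical
  have hw := comul_component (n := 0) h g ha
  set y := component h g a
  rw [zero_add, corad_one] at hw
  set w := comul (R := k) y - y ⊗ₜ[k] (g : C) - (h : C) ⊗ₜ[k] y with hwdef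
  -- on the span of the grouplikes, `dualAt g` splits off the component along `g`
  have hg : ∀ b ∈ grouplikeSpan k C, hitR (dualAt g) b = dualAt g b • (g : C) := by
    intro b hb
    induction hb using Submodule.span_induction with
    | mem x hx =>
      obtain ⟨l, rfl⟩ := hx
      by_cases hl : l = g
      · simp [hl]
      · simp [dualAt_apply, hl]
    | zero => simp
    | add x y _ _ hx hy => simp [hx, hy, add_smul]
    | smul c x _ hx => simp [hx, smul_smul]
  have hw2 : (hitR (dualAt g)).lTensor C w = sliceR (dualAt g) w ⊗ₜ[k] (g : C) := by
    refine tensorSub_induction (p := fun w => (hitR (dualAt g)).lTensor C w =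
      sliceR (dualAt g) w ⊗ₜ[k] (g : C)) hw (fun a _ b hb => ?_) (by simp) (fun s t hs ht => ?_)
    · simp [hg b hb, TensorProduct.smul_tmul]
    · simp only [map_add, hs, ht, TensorProduct.add_tmul]
  have hs : sliceR (dualAt g) w ∈ grouplikeSpan k C :=
    tensorSub_induction (p := fun w => sliceR (dualAt g) w ∈ _) hw (fun a ha b _ => by
      rw [sliceR_tmul]; exact Submodule.smul_mem _ _ ha) (by simp)
      (fun s t hs ht => by rw [map_add]; exact Submodule.add_mem _ hs ht)
  have hs' : sliceR (dualAt g) w = hitR (dualAt g) y - y - dualAt g y • (h : C) := by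
    rw [hwdef, map_sub, map_sub, sliceR_tmul, sliceR_tmul, dualAt_self, one_smul, hitR_apply]
  have hcy : comul (R := k) y = w + y ⊗ₜ[k] (g : C) + (h : C) ⊗ₜ[k] y := by
    rw [hwdef]; abel
  refine ⟨hitR (dualAt g) y - dualAt g y • (h : C), ?_, ?_⟩
  · rw [show y - (hitR (dualAt g) y - dualAt g y • (h : C)) = -sliceR (dualAt g) w by
      rw [hs']; abel]
    exact Submodule.neg_mem _ hs
  · rw [map_sub, comul_hitR, hcy, map_add, map_add, hw2, hs', map_smul,
      h.2.comul_eq_tmul_self]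
    simp only [LinearMap.lTensor_tmul, hitR_groupLike, dualAt_self, one_smul,
      TensorProduct.sub_tmul, TensorProduct.tmul_sub, TensorProduct.smul_tmul',
      TensorProduct.tmul_smul]
    abel

end Filtration

/-! ### Exhaustion in the pointed case -/

section Pointed

variable {k : Type u} {C : Type v} [Field k] [AddCommGroup C] [Module k C] [Coalgebra k C]
  [FiniteDimensional k C]

/-- A module over the dual algebra of a finite-dimensional coalgebra, given by its action map, is
a right comodule: `ρ(v) = ∑ᵢ (bⁱ ⇀ v) ⊗ bᵢ` for a basis `bᵢ` with dual basis `bⁱ`. -/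
noncomputable def comoduleOfAction {V : Type v} [AddCommGroup V] [Module k V]
    (act : Dual k C →ₗ[k] V →ₗ[k] V)
    (hmul : ∀ f g v, act f (act g v) = act (f ∘ₗ hitR g) v)
    (hone : ∀ v, act counit v = v) : RightComodule k C V where
  coact := ∑ i, (TensorProduct.mk k V C).flip (finBasis k C i) ∘ₗ act ((finBasis k C).coord i)
  coassoc := by
    set b := finBasis k C
    have hexp : ∀ f : Dual k C, ∀ v, act f v = ∑ l, f (b l) • act (b.coord l) v := by
      intro f v
      conv_lhs => rw [← b.sum_dual_apply_smul_coord f]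
      simp only [map_sum, map_smul, LinearMap.sum_apply, LinearMap.smul_apply]
    have hcomul : ∀ c : C, comul (R := k) c =
        ∑ j, ∑ l, (b.coord j ∘ₗ hitR (b.coord l)) c • (b j ⊗ₜ[k] b l) := by
      intro c
      rw [← sum_sliceR_tmul (comul (R := k) c), Finset.sum_comm]
      refine Finset.sum_congr rfl fun l _ => ?_
      conv_lhs => rw [← b.sum_repr (sliceR ((finBasis k C).coord l) (comul (R := k) c))]
      simp only [TensorProduct.sum_tmul, TensorProduct.smul_tmul']
      rfl
    ext v
    simp only [LinearMap.comp_apply, LinearMap.sum_apply, map_sum, LinearMap.flip_apply,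
      TensorProduct.mk_apply, LinearMap.rTensor_tmul, LinearMap.lTensor_tmul,
      TensorProduct.sum_tmul, LinearEquiv.coe_coe, TensorProduct.assoc_tmul, hmul]
    simp_rw [hcomul, hexp (b.coord _ ∘ₗ hitR _), TensorProduct.tmul_sum, TensorProduct.sum_tmul,
      TensorProduct.tmul_smul, TensorProduct.smul_tmul']
    rw [Finset.sum_comm]
    conv_rhs => rw [Finset.sum_comm]
    refine Finset.sum_congr rfl fun j _ => ?_
    conv_rhs => rw [Finset.sum_comm]
  counital := by
    set b := finBasis k C
    ext v
    simp only [LinearMap.comp_apply, LinearMap.sum_apply, map_sum, LinearMap.flip_apply,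
      TensorProduct.mk_apply, LinearMap.lTensor_tmul, LinearEquiv.coe_coe, TensorProduct.rid_tmul,
      LinearMap.id_apply]
    conv_rhs => rw [← hone v, ← b.sum_dual_apply_smul_coord (counit (R := k) (A := C))]
    simp only [map_sum, map_smul, LinearMap.sum_apply, LinearMap.smul_apply]

/-- Subcomodules of `comoduleOfAction` are stable under the action. -/
lemma act_mem_of_isSubcomodule {V : Type v} [AddCommGroup V] [Module k V]
    (act : Dual k C →ₗ[k] V →ₗ[k] V) (hmul) (hone) {W : Submodule k V}
    (hW : (comoduleOfAction act hmul hone).IsSubcomodule W) (f : Dual k C) {w : V} (hw : w ∈ W) :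
    act f w ∈ W := by
  have h1 : act f w = TensorProduct.rid k V
      (f.lTensor V ((comoduleOfAction act hmul hone).coact w)) := by
    conv_lhs => rw [← (finBasis k C).sum_dual_apply_smul_coord f]
    simp only [comoduleOfAction, map_sum, map_smul, LinearMap.sum_apply, LinearMap.smul_apply,
      LinearMap.comp_apply, LinearMap.flip_apply, TensorProduct.mk_apply, LinearMap.lTensor_tmul,
      TensorProduct.rid_tmul]
  obtain ⟨t, ht⟩ := hW w hw
  rw [h1, ← ht]
  clear ht
  induction t with
  | zero => simp
  | tmul a c => simpa using W.smul_mem _ a.2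
  | add s t hs ht => rw [map_add, map_add, map_add]; exact W.add_mem hs ht

/-- A character of the dual algebra is evaluation at a grouplike element. -/
lemma exists_groupLike_of_character (χ : Dual k C →ₗ[k] k)
    (hmul : ∀ f g, χ (f ∘ₗ hitR g) = χ f * χ g) (hone : χ counit = 1) :
    ∃ g : GroupLike k C, ∀ f, χ f = f g := by
  obtain ⟨g, hg⟩ := (Module.evalEquiv k C).surjective χ
  have hg' : ∀ f, χ f = f g := fun f => by rw [← hg]; rfl
  refine ⟨⟨g, by rw [← hg', hone], ?_⟩, hg'⟩
  refine eq_of_sliceR_eq fun f => ?_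
  refine (Module.forall_dual_apply_eq_zero_iff k _).1 (fun φ => ?_) |> sub_eq_zero.1
  have := hmul φ f
  rw [hg', hg', hg', LinearMap.comp_apply, hitR_apply] at this
  rw [map_sub, this, sliceR_tmul, map_smul, smul_eq_mul, mul_comm, sub_self]

/-- Modulo a proper subcomodule, a pointed coalgebra has an element on which the dual algebra acts
through evaluation at a grouplike element. -/
lemma exists_eigenvector (hp : IsPointedCoalgebra k C) {F : Submodule k C}
    (hF : ∀ f : Dual k C, ∀ a ∈ F, hitR f a ∈ F) (hne : F ≠ ⊤) :
    ∃ v ∉ F, ∃ g : GroupLike k C, ∀ f : Dual k C, hitR f v - f g • v ∈ F := by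
  -- the action on the quotient by `F`
  let act : Dual k C →ₗ[k] (C ⧸ F) →ₗ[k] (C ⧸ F) :=
    { toFun := fun f => F.mapQ F (hitR f) (hF f)
      map_add' := fun f g => by
        ext a; simp [hitR_add]
      map_smul' := fun c f => by
        ext a; simp [hitR_smul] }
  have hact : ∀ f a, act f (F.mkQ a) = F.mkQ (hitR f a) := fun f a => rfl
  -- a minimal nonzero stable subspace of the quotient
  let P : Set (Submodule k (C ⧸ F)) := {W | W ≠ ⊥ ∧ ∀ f, ∀ w ∈ W, act f w ∈ W}
  have hP : P.Nonempty := by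
    refine ⟨⊤, ?_, fun _ _ _ => trivial⟩
    have : Nontrivial (C ⧸ F) := Submodule.Quotient.nontrivial_iff.2 hne
    exact top_ne_bot
  obtain ⟨W, ⟨hW0, hWs⟩, hmin⟩ := WellFounded.has_min
    (wellFounded_lt (α := Submodule k (C ⧸ F))) P hP
  let actW : Dual k C →ₗ[k] W →ₗ[k] W :=
    { toFun := fun f => (act f).restrict (hWs f)
      map_add' := fun f g => by ext a; simp
      map_smul' := fun c f => by ext a; simp }
  have hactW : ∀ f w, ((actW f w : W) : C ⧸ F) = act f w := fun f w => rfl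
  have hmulQ : ∀ f g v, act f (act g v) = act (f ∘ₗ hitR g) v := by
    intro f g v
    obtain ⟨a, rfl⟩ := F.mkQ_surjective v
    rw [hact, hact, hact, hitR_hitR]
  have honeQ : ∀ v, act counit v = v := by
    intro v
    obtain ⟨a, rfl⟩ := F.mkQ_surjective v
    rw [hact, hitR_counit]
  have hmulW : ∀ f g v, actW f (actW g v) = actW (f ∘ₗ hitR g) v := fun f g v =>
    Subtype.ext (by rw [hactW, hactW, hactW, hmulQ])
  have honeW : ∀ v, actW counit v = v := fun v => Subtype.ext (by rw [hactW, honeQ])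
  have hsimple : (comoduleOfAction actW hmulW honeW).IsSimple := by
    refine ⟨Submodule.nontrivial_iff_ne_bot.2 hW0, fun U hU => ?_⟩
    by_contra! hcon
    have hUP : U.map W.subtype ∈ P := by
      refine ⟨fun h => hcon.1 (Submodule.map_injective_of_injective W.injective_subtype ?_), ?_⟩
      · rw [h, Submodule.map_bot]
      rintro f _ ⟨w, hw, rfl⟩
      exact ⟨actW f w, act_mem_of_isSubcomodule actW hmulW honeW hU f hw, rfl⟩
    refine hmin _ hUP (lt_of_le_of_ne (Submodule.map_subtype_le W U) fun h => hcon.2 ?_)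
    apply Submodule.map_injective_of_injective W.injective_subtype
    rw [h, Submodule.map_top, Submodule.range_subtype]
  obtain ⟨w, hw0, hw⟩ := finrank_eq_one_iff'.1 (hp W _ hsimple)
  -- the character by which the dual algebra acts on the line
  choose χ hχ using fun f => hw (actW f w)
  have hinj : ∀ c d : k, c • w = d • w → c = d := fun c d h => smul_left_injective k hw0 h
  let χ' : Dual k C →ₗ[k] k :=
    { toFun := χ
      map_add' := fun f g => hinj _ _ (by rw [add_smul, hχ, hχ, hχ, map_add]; rfl)
      map_smul' := fun c f => hinj _ _ (by
        rw [hχ, map_smul, LinearMap.smul_apply, ← hχ, smul_smul]; rfl) }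
  obtain ⟨g, hg⟩ := exists_groupLike_of_character χ'
    (fun f g => hinj _ _ (by
      change χ _ • w = (χ f * χ g) • w
      rw [hχ, ← hmulW, ← hχ g, map_smul, ← hχ f, smul_smul, mul_comm]))
    (hinj _ _ (by change χ _ • w = _; rw [hχ, honeW, one_smul]))
  obtain ⟨v, hv⟩ := F.mkQ_surjective (w : C ⧸ F)
  refine ⟨v, fun hvF => hw0 (Subtype.ext ?_), g, fun f => ?_⟩
  · rw [← hv]; simpa using hvF
  · rw [← Submodule.ker_mkQ F, LinearMap.mem_ker, map_sub, map_smul, ← hact, hv, ← hactW, ← hχ f,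
      sub_eq_zero]
    simp [← hg, χ']

/-- The coradical filtration of a finite-dimensional pointed coalgebra is exhaustive. -/
lemma exists_corad_eq_top (hp : IsPointedCoalgebra k C) : ∃ N, corad k C N = ⊤ := by
  obtain ⟨N, hN⟩ := monotone_stabilizes_iff_noetherian.2 (inferInstance : IsNoetherian k C)
    ⟨corad k C, corad_mono⟩
  refine ⟨N, by_contra fun hne => ?_⟩
  obtain ⟨v, hv, g, hvg⟩ := exists_eigenvector hp (fun f a ha => hitR_mem_corad f ha) hne
  refine hv ?_
  have : corad k C N = corad k C (N + 1) := hN (N + 1) (Nat.le_succ N)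
  rw [this]
  intro f hf
  simpa [mem_augJ.1 hf g] using hvg f

end Pointed

/-! ### Multiplicativity of the coradical filtration -/

section Mult

variable {k : Type u} {H : Type v} [Field k] [Ring H] [HopfAlgebra k H] 

lemma mul_mem_grouplikeSpan {a b : H} (ha : a ∈ grouplikeSpan k H) (hb : b ∈ grouplikeSpan k H) :
    a * b ∈ grouplikeSpan k H := by
  have h : a * b ∈ grouplikeSpan k H * grouplikeSpan k H := Submodule.mul_mem_mul ha hb
  rw [grouplikeSpan, Submodule.span_mul_span] at h
  refine Submodule.span_mono ?_ h
  rintro _ ⟨_, ⟨g, rfl⟩, _, ⟨g', rfl⟩, rfl⟩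
  exact ⟨g * g', rfl⟩

variable [FiniteDimensional k H]

/-- The coradical filtration is multiplicative, once its bottom term is closed under products. -/
lemma mul_mem_corad_succ {m n : ℕ} {a b : H} (ha : a ∈ corad k H (m + 1))
    (hb : b ∈ corad k H (n + 1)) : a * b ∈ corad k H (m + n + 1) := by
  obtain ⟨s, hs⟩ : ∃ s, m + n = s := ⟨_, rfl⟩
  induction s using Nat.strong_induction_on generalizing m n a b with
  | _ s ih =>
  have hlt1 : ∀ u ∈ corad k H m, ∀ w ∈ corad k H (n + 1), u * w ∈ corad k H (m + n) := by
    intro u hu w hw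
    cases m with
    | zero => rw [mem_corad_zero.1 hu, zero_mul]; exact Submodule.zero_mem _
    | succ m =>
      rw [show m + 1 + n = m + n + 1 by omega]
      exact ih (m + n) (by omega) hu hw rfl
  have hlt2 : ∀ u ∈ corad k H (m + 1), ∀ w ∈ corad k H n, u * w ∈ corad k H (m + n) := by
    intro u hu w hw
    cases n with
    | zero => rw [mem_corad_zero.1 hw, mul_zero]; exact Submodule.zero_mem _
    | succ n =>
      rw [← add_assoc]
      exact ih (m + n) (by omega) hu hw rfl
  intro f hf
  rw [hitR_apply, Bialgebra.comul_mul]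
  obtain ⟨s₁, hs₁, s₂, hs₂, hs⟩ := Submodule.mem_sup.1 (comul_mem_tensorSub ha)
  obtain ⟨t₁, ht₁, t₂, ht₂, ht⟩ := Submodule.mem_sup.1 (comul_mem_tensorSub hb)
  -- a product of two pure-tensor spans is sliced into any subspace containing the products
  have key : ∀ (U W U' W' : Submodule k H) (t t' : H ⊗[k] H), t ∈ tensorSub U W →
      t' ∈ tensorSub U' W' → (∀ u ∈ U, ∀ w ∈ W, ∀ u' ∈ U', ∀ w' ∈ W',
        f (w * w') • (u * u') ∈ corad k H (m + n)) →
      sliceR f (t * t') ∈ corad k H (m + n) := by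
    intro U W U' W' t t' ht ht' h
    refine tensorSub_induction (p := fun t => sliceR f (t * t') ∈ corad k H (m + n)) ht
      (fun u hu w hw => ?_) (by simp) (fun s t hs ht => ?_)
    · refine tensorSub_induction (p := fun t' => sliceR f (u ⊗ₜ w * t') ∈ corad k H (m + n)) ht'
        (fun u' hu' w' hw' => ?_) (by simp) (fun s t hs ht => ?_)
      · rw [Algebra.TensorProduct.tmul_mul_tmul, sliceR_tmul]
        exact h u hu w hw u' hu' w' hw'
      · rw [mul_add, map_add]; exact Submodule.add_mem _ hs ht
    · rw [add_mul, map_add]; exact Submodule.add_mem _ hs ht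
  have hmono : corad k H n ≤ corad k H (n + 1) := corad_mono (Nat.le_succ n)
  rw [← hs, ← ht, add_mul, mul_add, map_add, map_add]
  refine Submodule.add_mem _ (Submodule.add_mem _ ?_ ?_) ?_
  · refine key _ _ _ _ _ _ hs₁ ht₁ fun u _ w hw u' _ w' hw' => ?_
    rw [apply_eq_zero_of_mem_augJ hf (mul_mem_grouplikeSpan hw hw'), zero_smul]
    exact Submodule.zero_mem _
  · exact key _ _ _ _ _ _ hs₁ ht₂ fun u hu w _ u' hu' w' _ =>
      Submodule.smul_mem _ _ (hlt2 u hu u' hu')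
  · rw [mul_add, map_add]
    refine Submodule.add_mem _ ?_ ?_
    · exact key _ _ _ _ _ _ hs₂ ht₁ fun u hu w _ u' hu' w' _ =>
        Submodule.smul_mem _ _ (hlt1 u hu u' hu')
    · exact key _ _ _ _ _ _ hs₂ ht₂ fun u hu w _ u' hu' w' _ =>
        Submodule.smul_mem _ _ (hlt1 u hu u' (hmono hu'))

lemma mul_mem_corad_right {m n : ℕ} {a b : H} (ha : a ∈ corad k H m)
    (hb : b ∈ corad k H (n + 1)) : a * b ∈ corad k H (m + n) := by
  cases m with
  | zero => rw [mem_corad_zero.1 ha, zero_mul]; exact Submodule.zero_mem _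
  | succ m => rw [add_right_comm]; exact mul_mem_corad_succ ha hb

lemma mul_mem_corad_left {m n : ℕ} {a b : H} (ha : a ∈ corad k H (m + 1))
    (hb : b ∈ corad k H n) : a * b ∈ corad k H (m + n) := by
  cases n with
  | zero => rw [mem_corad_zero.1 hb, mul_zero]; exact Submodule.zero_mem _
  | succ n => exact mul_mem_corad_succ ha hb

lemma groupLike_mul_mem_corad (g : GroupLike k H) {n : ℕ} {a : H} (ha : a ∈ corad k H n) :
    (g : H) * a ∈ corad k H n := by
  simpa using mul_mem_corad_left (groupLike_mem_corad g 0) ha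

lemma mul_groupLike_mem_corad (g : GroupLike k H) {n : ℕ} {a : H} (ha : a ∈ corad k H n) :
    a * (g : H) ∈ corad k H n := by
  simpa using mul_mem_corad_right ha (groupLike_mem_corad g 0)

end Mult

/-! ### Commutation with grouplike elements -/

section Cotriangular

variable {k : Type u} {H : Type v} [Field k] [Ring H] [HopfAlgebra k H] {r : H →ₗ[k] H →ₗ[k] k}

lemma cotriangular_mul_left (hr : IsCotriangularForm r) (a b : H) (g : GroupLike k H) :
    r (a * b) g = r a g * r b g := by
  rw [hr.mul_left, g.2.comul_eq_tmul_self]; simp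

lemma cotriangular_mul_right (hr : IsCotriangularForm r) (g : GroupLike k H) (b c : H) :
    r g (b * c) = r g b * r g c := by
  rw [hr.mul_right, g.2.comul_eq_tmul_self]; simp [mul_comm]

lemma cotriangular_inverse (hr : IsCotriangularForm r) (g h : GroupLike k H) :
    r g h * r h g = 1 := by
  have := hr.inverse (g : H) (h : H)
  simpa [TensorProduct.comul_tmul, g.2.comul_eq_tmul_self, h.2.comul_eq_tmul_self] using this

lemma cotriangular_ne_zero (hr : IsCotriangularForm r) (g h : GroupLike k H) :
    r (g : H) h ≠ 0 := left_ne_zero_of_mul_eq_one (cotriangular_inverse hr g h)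

lemma cotriangular_one_left (hr : IsCotriangularForm r) (g : GroupLike k H) :
    r 1 (g : H) = 1 := by
  have h := cotriangular_mul_left hr 1 1 g
  rw [mul_one] at h
  have h0 : r 1 (g : H) ≠ 0 := by simpa using cotriangular_ne_zero hr 1 g
  exact (mul_eq_left₀ h0).1 h.symm

/-- Conjugation by a grouplike element `g` is given by the two actions of the functional
`r(·, g)`. -/
lemma cotriangular_commutation (hr : IsCotriangularForm r) (a : H) (g : GroupLike k H) :
    hitL (r.flip g) a * g = g * hitR (r.flip g) a := by
  have h := hr.commutation a (g : H)
  have h1 : ∀ t : H ⊗[k] H, TensorProduct.lid k H (TensorProduct.map (TensorProduct.lift r)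
      (LinearMap.mul' k H) (TensorProduct.AlgebraTensorModule.tensorTensorTensorComm k k k k H H H H
        (t ⊗ₜ[k] ((g : H) ⊗ₜ[k] (g : H))))) = sliceL (r.flip g) t * g := by
    intro t
    induction t with
    | zero => simp
    | tmul a b => simp
    | add s t hs ht => simp only [TensorProduct.add_tmul, map_add, hs, ht, add_mul]
  have h2 : ∀ t : H ⊗[k] H, TensorProduct.rid k H (TensorProduct.map
      (LinearMap.mul' k H ∘ₗ (TensorProduct.comm k H H).toLinearMap) (TensorProduct.lift r)
      (TensorProduct.AlgebraTensorModule.tensorTensorTensorComm k k k k H H H H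
        (t ⊗ₜ[k] ((g : H) ⊗ₜ[k] (g : H))))) = g * sliceR (r.flip g) t := by
    intro t
    induction t with
    | zero => simp
    | tmul a b => simp
    | add s t hs ht => simp only [TensorProduct.add_tmul, map_add, hs, ht, mul_add]
  rw [TensorProduct.comul_tmul, g.2.comul_eq_tmul_self, h1, h2] at h
  exact h

lemma groupLike_mul_comm (hr : IsCotriangularForm r) (g h : GroupLike k H) : g * h = h * g := by
  have := cotriangular_commutation hr (g : H) h
  rw [hitL_groupLike, hitR_groupLike, smul_mul_assoc, mul_smul_comm] at this
  exact GroupLike.ext (smul_right_injective H (cotriangular_ne_zero hr g h) this)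

variable [FiniteDimensional k H]

/-- Up to lower order terms, an element of left degree `g` and right degree `1` commutes with a
grouplike element `h` up to the scalar `r(g, h)`. -/
lemma groupLike_mul_sub_mem (hr : IsCotriangularForm r) {m : ℕ} {y : H} {g : GroupLike k H}
    (hy : comul (R := k) y - y ⊗ₜ[k] (1 : H) - (g : H) ⊗ₜ[k] y ∈
      tensorSub (corad k H (m + 1)) (corad k H (m + 1))) (h : GroupLike k H) :
    (h : H) * y - r g h • (y * (h : H)) ∈ corad k H (m + 1) := by
  set w := comul (R := k) y - y ⊗ₜ[k] (1 : H) - (g : H) ⊗ₜ[k] y with hw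
  have hcy : comul (R := k) y = w + y ⊗ₜ[k] (1 : H) + (g : H) ⊗ₜ[k] y := by rw [hw]; abel
  have hwR : sliceR (r.flip h) w ∈ corad k H (m + 1) :=
    tensorSub_induction (p := fun w => sliceR (r.flip h) w ∈ corad k H (m + 1)) hy
      (fun a ha b _ => by rw [sliceR_tmul]; exact Submodule.smul_mem _ _ ha) (by simp)
      (fun s t hs ht => by rw [map_add]; exact Submodule.add_mem _ hs ht)
  have hwL : sliceL (r.flip h) w ∈ corad k H (m + 1) :=
    tensorSub_induction (p := fun w => sliceL (r.flip h) w ∈ corad k H (m + 1)) hy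
      (fun a _ b hb => by rw [sliceL_tmul]; exact Submodule.smul_mem _ _ hb) (by simp)
      (fun s t hs ht => by rw [map_add]; exact Submodule.add_mem _ hs ht)
  have key := cotriangular_commutation hr y h
  rw [hitL_apply, hitR_apply, hcy] at key
  simp only [map_add, sliceL_tmul, sliceR_tmul, LinearMap.flip_apply,
    cotriangular_one_left hr h, one_smul, add_mul, mul_add, smul_mul_assoc, one_mul,
    mul_smul_comm] at key
  have : (h : H) * y - r g h • (y * (h : H)) = sliceL (r.flip h) w * h + r y h • (h : H) -
      h * sliceR (r.flip h) w - r y h • ((h : H) * g) := by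
    rw [sub_eq_iff_eq_add, ← sub_eq_zero]
    rw [← sub_eq_zero] at key
    rw [← neg_eq_zero, ← key]
    abel
  rw [this]
  refine Submodule.sub_mem _ (Submodule.sub_mem _ (Submodule.add_mem _ ?_ ?_) ?_) ?_
  · exact mul_groupLike_mem_corad h hwL
  · exact Submodule.smul_mem _ _ (groupLike_mem_corad h m)
  · exact groupLike_mul_mem_corad h hwR
  · exact Submodule.smul_mem _ _ (groupLike_mem_corad (h * g) m)

end Cotriangular

/-! ### Absence of even generators -/

section Even

variable {k : Type u} {H : Type v} [Field k] [Ring H] [HopfAlgebra k H]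

lemma sliceR_mul_tmul (z : Dual k H) (t : H ⊗[k] H) (u v : H) :
    sliceR z (t * (u ⊗ₜ[k] v)) = sliceR (z ∘ₗ LinearMap.mulRight k v) t * u := by
  induction t with
  | zero => simp
  | tmul a b => simp
  | add s t hs ht => simp only [add_mul, map_add, hs, ht]

variable [FiniteDimensional k H]

/-- A functional that kills products of lower order elements acts as a derivation up to lower
order terms. -/
lemma hitR_mul_sub_mem {m n : ℕ} {y a : H} {g : GroupLike k H} {z : Dual k H}
    (hy : comul (R := k) y - y ⊗ₜ[k] (1 : H) - (g : H) ⊗ₜ[k] y ∈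
      tensorSub (corad k H (m + 1)) (corad k H (m + 1)))
    (hz : ∀ u ∈ corad k H (m + 1), ∀ v ∈ corad k H (m + 1), z (u * v) = 0)
    (hzy : ∀ h : GroupLike k H, z (h * y) = 1) (ha : a ∈ corad k H (n + 1)) :
    hitR z (a * y) - (hitR z a * y + a * g) ∈ corad k H n := by
  set w := comul (R := k) y - y ⊗ₜ[k] (1 : H) - (g : H) ⊗ₜ[k] y with hw
  have hcy : comul (R := k) y = y ⊗ₜ[k] (1 : H) + (g : H) ⊗ₜ[k] y + w := by rw [hw]; abel
  have h1 : z ∘ₗ LinearMap.mulRight k (1 : H) = z := by ext; simp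
  have h2 : z ∘ₗ LinearMap.mulRight k y - counit ∈ augJ k H :=
    mem_augJ.2 fun h => by simp [hzy]
  have h3 := mul_groupLike_mem_corad g (ha _ h2)
  rw [hitR_sub, hitR_counit, sub_mul] at h3
  have h4 : sliceR z (comul a * w) ∈ corad k H n := by
    refine tensorSub_induction (p := fun w => sliceR z (comul a * w) ∈ corad k H n) hy
      (fun u hu v hv => ?_) (by simp)
      (fun s t hs ht => by rw [mul_add, map_add]; exact Submodule.add_mem _ hs ht)
    rw [sliceR_mul_tmul, ← hitR_apply]
    have h5 := hitR_mem_corad_sub (z := z ∘ₗ LinearMap.mulRight k v) (m := m + 1)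
      (fun b hb => hz b hb v hv) ha
    rcases lt_or_ge n m with hnm | hnm
    · rw [show n + 1 - (m + 1) = 0 by omega, mem_corad_zero] at h5
      rw [h5, zero_mul]; exact Submodule.zero_mem _
    · have h6 := mul_mem_corad_right h5 hu
      rwa [show n + 1 - (m + 1) + m = n by omega] at h6
  have : hitR z (a * y) - (hitR z a * y + a * g) =
      (hitR (z ∘ₗ LinearMap.mulRight k y) a * g - a * g) + sliceR z (comul a * w) := by
    rw [hitR_apply z (a * y), Bialgebra.comul_mul, hcy, mul_add, mul_add, map_add, map_add,
      sliceR_mul_tmul, sliceR_mul_tmul, h1, ← hitR_apply, ← hitR_apply]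
    abel
  rw [this]
  exact Submodule.add_mem _ h3 h4

lemma pow_mem_corad {m : ℕ} {y : H} (hy : y ∈ corad k H (m + 1)) (n : ℕ) :
    y ^ n ∈ corad k H (m * n + 1) := by
  induction n with
  | zero => simpa using groupLike_mem_corad (1 : GroupLike k H) 0
  | succ n ih => rw [pow_succ, mul_add, mul_one]; exact mul_mem_corad_succ ih hy

/-- There is no new generator of even degree: an element `y` commuting with its own degree `g`
up to lower order terms, primitive up to lower order terms, and detected by a functional `z`
killing the products of lower order elements, would satisfy `z ⇀ yⁿ⁺¹ = (n + 1) yⁿ g` up to lower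
order terms, so that its powers would leave every term of the filtration. -/
lemma false_of_even_generator [CharZero k] {N : ℕ} (hN : corad k H N = ⊤) {m : ℕ} {y : H}
    {g : GroupLike k H} {z : Dual k H} (hym : y ∈ corad k H (m + 2))
    (hy : comul (R := k) y - y ⊗ₜ[k] (1 : H) - (g : H) ⊗ₜ[k] y ∈
      tensorSub (corad k H (m + 1)) (corad k H (m + 1)))
    (hz : ∀ u ∈ corad k H (m + 1), ∀ v ∈ corad k H (m + 1), z (u * v) = 0)
    (hzy : ∀ h : GroupLike k H, z (h * y) = 1)
    (hgy : (g : H) * y - y * g ∈ corad k H (m + 1)) : False := by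
  have hd : ∀ n : ℕ, hitR z (y ^ (n + 1)) - ((n : k) + 1) • (y ^ n * g) ∈
      corad k H ((m + 1) * n) := by
    intro n
    induction n with
    | zero =>
      have := hitR_mul_sub_mem (n := 0) hy hz hzy (groupLike_mem_corad (1 : GroupLike k H) 0)
      have h1m : (1 : H) ∈ corad k H (m + 1) := groupLike_mem_corad (1 : GroupLike k H) m
      have hz1 : z 1 = 0 := by simpa using hz 1 h1m 1 h1m
      have h1 : hitR z (1 : H) = 0 := by
        simpa [hz1] using hitR_groupLike z (1 : GroupLike k H)
      simpa [h1] using this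
    | succ n ih =>
      have h1 := hitR_mul_sub_mem (n := (m + 1) * (n + 1)) hy hz hzy (pow_mem_corad hym (n + 1))
      have h2 := mul_mem_corad_right ih hym
      have h3 := mul_mem_corad_left (pow_mem_corad hym n) hgy
      rw [show (m + 1) * n + (m + 1) = (m + 1) * (n + 1) by ring] at h2 h3
      have := Submodule.add_mem _ (Submodule.add_mem _ h1 h2)
        (Submodule.smul_mem _ ((n : k) + 1) h3)
      convert this using 1
      rw [pow_succ y (n + 1), sub_mul, smul_mul_assoc, mul_sub, smul_sub]
      have e1 : y ^ n * (y * (g : H)) = y ^ (n + 1) * g := by rw [pow_succ, mul_assoc]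
      rw [e1, mul_assoc (y ^ n)]
      push_cast
      rw [add_smul ((n : k) + 1), one_smul]
      abel
  have hker : ∀ a ∈ corad k H (m + 1), z a = 0 := fun a ha => by
    simpa using hz a ha 1 (by simpa using groupLike_mem_corad (1 : GroupLike k H) m)
  have hdesc : ∀ n : ℕ, y ^ n ∉ corad k H ((m + 1) * n) := by
    intro n
    induction n with
    | zero =>
      intro h
      have := (groupLike_mem_corad (1 : GroupLike k H) 0)
      rw [pow_zero, mul_zero, mem_corad_zero] at h
      have := (1 : GroupLike k H).2.ne_zero
      exact this h
    | succ n ih =>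
      intro h
      have h1 := hitR_mem_corad_sub hker h
      rw [show (m + 1) * (n + 1) - (m + 1) = (m + 1) * n by
        rw [mul_add, mul_one, Nat.add_sub_cancel]] at h1
      have h2 := Submodule.sub_mem _ h1 (hd n)
      rw [sub_sub_cancel] at h2
      have h3 : y ^ n * (g : H) ∈ corad k H ((m + 1) * n) :=
        (Submodule.smul_mem_iff _ (by exact_mod_cast Nat.succ_ne_zero n)).1 h2
      have h4 := mul_groupLike_mem_corad g⁻¹ h3
      rw [mul_assoc, ← GroupLike.val_mul, mul_inv_cancel, GroupLike.val_one, mul_one] at h4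
      exact ih h4
  refine hdesc N (corad_mono (show N ≤ (m + 1) * N from Nat.le_mul_of_pos_left N m.succ_pos) ?_)
  rw [hN]; trivial

end Even

/-! ### Homogeneous frames of the first layer -/

section Frame

/-- A homogeneous frame for `H_1 / H_0`: skew-primitive elements `x i` with
`Δ(x i) = x i ⊗ 1 + deg i ⊗ x i` whose translates `h * x i` by grouplike elements span `H_1` modulo
`H_0`, and dual functionals `f i` that do not see the grouplike factor `h`. -/
structure SkewFrame (k : Type u) (H : Type v) [Field k] [Ring H] [HopfAlgebra k H]
    (ι : Type v) where
  /-- The degree of a frame element. -/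
  deg : ι → GroupLike k H
  /-- The frame elements. -/
  x : ι → H
  /-- The dual functionals. -/
  f : ι → Dual k H
  comul_x (i : ι) : comul (R := k) (x i) = x i ⊗ₜ[k] (1 : H) + (deg i : H) ⊗ₜ[k] x i
  f_mem (i : ι) : f i ∈ augJ k H
  f_mul_self (i : ι) (h : GroupLike k H) : f i (h * x i) = 1
  f_mul_of_ne {i j : ι} (hij : i ≠ j) (h : GroupLike k H) : f i (h * x j) = 0
  corad_two_le : corad k H 2 ≤ grouplikeSpan k H ⊔
    Submodule.span k (Set.range fun p : GroupLike k H × ι => (p.1 : H) * x p.2)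

variable {k : Type u} {H : Type v} [Field k] [Ring H] [HopfAlgebra k H]

lemma comul_groupLike_mul {x y a b : H} (h : GroupLike k H)
    (hx : comul (R := k) x = x ⊗ₜ[k] a + b ⊗ₜ[k] y) :
    comul (R := k) (h * x) = (h * x) ⊗ₜ[k] (h * a) + (h * b) ⊗ₜ[k] (h * y) := by
  rw [Bialgebra.comul_mul, hx, h.2.comul_eq_tmul_self, mul_add, Algebra.TensorProduct.tmul_mul_tmul,
    Algebra.TensorProduct.tmul_mul_tmul]

lemma inv_mul_cancel_val (h : GroupLike k H) (a : H) :
    ((h⁻¹ : GroupLike k H) : H) * ((h : H) * a) = a := by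
  rw [← mul_assoc, ← GroupLike.val_mul, inv_mul_cancel, GroupLike.val_one, one_mul]

lemma mul_inv_cancel_val (h : GroupLike k H) (a : H) :
    (h : H) * (((h⁻¹ : GroupLike k H) : H) * a) = a := by
  rw [← mul_assoc, ← GroupLike.val_mul, mul_inv_cancel, GroupLike.val_one, one_mul]

/-- The skew-primitive elements `x` with `Δ(x) = x ⊗ 1 + g ⊗ x`. -/
def skewPrim (g : GroupLike k H) : Submodule k H where
  carrier := {x | comul (R := k) x = x ⊗ₜ[k] (1 : H) + (g : H) ⊗ₜ[k] x}
  add_mem' {x y} hx hy := by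
    simp only [Set.mem_ofPred_eq] at *
    rw [map_add, hx, hy, TensorProduct.add_tmul, TensorProduct.tmul_add]; abel
  zero_mem' := by simp
  smul_mem' c x hx := by
    simp only [Set.mem_ofPred_eq] at *
    rw [map_smul, hx, smul_add, TensorProduct.tmul_smul, TensorProduct.smul_tmul']

lemma mem_skewPrim {g : GroupLike k H} {x : H} :
    x ∈ skewPrim g ↔ comul (R := k) x = x ⊗ₜ[k] (1 : H) + (g : H) ⊗ₜ[k] x := Iff.rfl

open Classical in
/-- The components of `h x`, for `x` skew-primitive of degree `γ`, sit in left degree `h γ` and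
right degree `h`, up to grouplike elements. -/
lemma mkQ_component_mul {γ : GroupLike k H} {x : H} (hx : x ∈ skewPrim γ) (h l g : GroupLike k H) :
    (grouplikeSpan k H).mkQ (((l⁻¹ : GroupLike k H) : H) * component (l * g) l (h * x)) =
      if l = h ∧ g = γ then (grouplikeSpan k H).mkQ x else 0 := by
  have h1 := comul_groupLike_mul h (mem_skewPrim.1 hx)
  have hv : (h : H) * γ = ((h * γ : GroupLike k H) : H) := rfl
  rw [mul_one, hv] at h1
  rw [component, LinearMap.comp_apply, hitR_of_comul_eq h1, map_add, map_smul, map_smul,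
    hitL_of_comul_eq h1, hitL_groupLike, mul_add, mul_smul_comm, mul_smul_comm, mul_add,
    mul_smul_comm, mul_smul_comm, mul_smul_comm, map_add, map_smul, map_smul, map_add, map_smul,
    map_smul, map_smul]
  have h2 : ∀ a b : GroupLike k H, (grouplikeSpan k H).mkQ ((a : H) * b) = 0 := fun a b =>
    (Submodule.Quotient.mk_eq_zero _).2 (groupLike_mem (a * b))
  rw [h2, h2, smul_zero, smul_zero, smul_zero, zero_add, add_zero, dualAt_apply, dualAt_apply]
  by_cases hl : h = l
  · subst hl
    by_cases hg : g = γ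
    · subst hg
      rw [inv_mul_cancel_val]
      simp
    · simp [hg, Ne.symm hg]
  · simp [hl, Ne.symm hl]

variable [FiniteDimensional k H]

lemma corad_two_le_skewPrim : corad k H 2 ≤ grouplikeSpan k H ⊔
    Submodule.span k {a | ∃ h g : GroupLike k H, ∃ x ∈ skewPrim g, a = h * x} := by
  cases nonempty_fintype (GroupLike k H)
  intro a ha
  have h1 := sub_sum_component_mem (n := 1) ha
  rw [corad_one] at h1
  rw [← sub_add_cancel a (∑ h : GroupLike k H, ∑ g : GroupLike k H, component h g a)]
  refine Submodule.add_mem _ (Submodule.mem_sup_left h1) ?_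
  refine Submodule.sum_mem _ fun h _ => Submodule.sum_mem _ fun g _ => ?_
  obtain ⟨x, hx, hcx⟩ := exists_skewPrimitive h g ha
  rw [← sub_add_cancel (component h g a) x]
  refine Submodule.add_mem_sup hx (Submodule.subset_span ⟨g, g⁻¹ * h, (g⁻¹ : GroupLike k H) * x, ?_,
    (mul_inv_cancel_val g x).symm⟩)
  have := comul_groupLike_mul g⁻¹ hcx
  rwa [← GroupLike.val_mul, ← GroupLike.val_mul, inv_mul_cancel, GroupLike.val_one] at this

variable (k H) in
open Classical in
/-- A finite-dimensional Hopf algebra has a finite homogeneous frame for `H_1 / H_0`. -/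
lemma exists_skewFrame : ∃ (ι : Type v) (_ : Fintype ι), Nonempty (SkewFrame k H ι) := by
  cases nonempty_fintype (GroupLike k H)
  let Q := (grouplikeSpan k H).mkQ
  let B : ∀ g : GroupLike k H, Basis _ k ((skewPrim g).map Q) := fun g => finBasis k _
  have hx : ∀ (g : GroupLike k H) (i), ∃ x ∈ skewPrim g, Q x = B g i := fun g i => (B g i).2
  choose x hxs hxQ using hx
  choose φ hφ using fun (g : GroupLike k H) i => ((B g).coord i).exists_extend
  have hφB : ∀ g i j, φ g i (Q (x g j)) = if i = j then 1 else 0 := by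
    intro g i j
    rw [hxQ]
    have := LinearMap.congr_fun (hφ g i) (B g j)
    simp only [LinearMap.comp_apply, Submodule.subtype_apply, Basis.coord_apply, Basis.repr_self,
      Finsupp.single_apply] at this
    rw [this]
    simp only [eq_comm]
  let f : (Σ g : GroupLike k H, Fin (finrank k ((skewPrim g).map Q))) → Dual k H := fun p =>
    ∑ l : GroupLike k H, φ p.1 p.2 ∘ₗ Q ∘ₗ
      LinearMap.mulLeft k ((l⁻¹ : GroupLike k H) : H) ∘ₗ component (l * p.1) l
  have hf : ∀ g i γ j (h : GroupLike k H), f ⟨g, i⟩ (h * x γ j) =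
      if g = γ then φ g i (Q (x γ j)) else 0 := by
    intro g i γ j h
    simp only [f, LinearMap.sum_apply, LinearMap.comp_apply, LinearMap.mulLeft_apply]
    simp_rw [show ∀ l : GroupLike k H, Q (((l⁻¹ : GroupLike k H) : H) *
      component (l * g) l (h * x γ j)) = if l = h ∧ g = γ then Q (x γ j) else 0 from
      fun l => mkQ_component_mul (hxs γ j) h l g]
    by_cases hg : g = γ <;> simp [hg, apply_ite]
  refine ⟨Σ g : GroupLike k H, Fin (finrank k ((skewPrim g).map Q)), inferInstance, ⟨{
    deg := fun p => p.1
    x := fun p => x p.1 p.2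
    f := f
    comul_x := fun p => hxs p.1 p.2
    f_mem := ?_
    f_mul_self := fun ⟨g, i⟩ h => by simp [hf, hφB]
    f_mul_of_ne := ?_
    corad_two_le := ?_ }⟩⟩
  · refine fun p => mem_augJ.2 fun g => ?_
    rw [LinearMap.sum_apply]
    refine Finset.sum_eq_zero fun l _ => ?_
    have : Q (((l⁻¹ : GroupLike k H) : H) * (g : H)) = 0 :=
      (Submodule.Quotient.mk_eq_zero _).2 (groupLike_mem (l⁻¹ * g))
    simp [component, this, -GroupLike.val_inv]
  · rintro ⟨g, i⟩ ⟨γ, j⟩ hne h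
    rw [hf]
    split_ifs with hg
    · subst hg
      rw [hφB, if_neg fun hij => hne (by rw [hij])]
    · rfl
  · refine corad_two_le_skewPrim.trans (sup_le le_sup_left (Submodule.span_le.2 ?_))
    rintro _ ⟨h, g, y, hy, rfl⟩
    have h1 : Q y ∈ Submodule.span k (Set.range fun i => Q (x g i)) := by
      simp_rw [hxQ]
      have := (B g).mem_span ⟨Q y, Submodule.mem_map_of_mem hy⟩
      have h2 := Submodule.mem_map_of_mem (f := ((skewPrim g).map Q).subtype) this
      rw [Submodule.map_span, ← Set.range_comp] at h2
      exact h2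
    rw [Set.range_comp' Q, ← Submodule.map_span] at h1
    obtain ⟨y', hy', hQ⟩ := h1
    have h2 : y - y' ∈ grouplikeSpan k H := by
      rw [← Submodule.Quotient.mk_eq_zero, Submodule.Quotient.mk_sub, sub_eq_zero]
      exact hQ.symm
    rw [← sub_add_cancel y y', mul_add]
    refine Submodule.add_mem_sup (mul_mem_grouplikeSpan (groupLike_mem h) h2) ?_
    have h3 := Submodule.mem_map_of_mem (f := LinearMap.mulLeft k (h : H)) hy'
    rw [Submodule.map_span, ← Set.range_comp] at h3
    refine Submodule.span_mono ?_ h3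
    rintro _ ⟨i, rfl⟩
    exact ⟨(h, ⟨g, i⟩), rfl⟩

end Frame

/-! ### Braided commutators and the Euler operator -/

section Commutation

variable {k : Type u} {H : Type v} [Field k] [Ring H] [HopfAlgebra k H]

lemma hitR_groupLike_mul (f : Dual k H) (h : GroupLike k H) (a : H) :
    hitR f (h * a) = h * hitR (f ∘ₗ LinearMap.mulLeft k (h : H)) a := by
  rw [hitR_apply, Bialgebra.comul_mul, h.2.comul_eq_tmul_self, hitR_apply]
  induction comul (R := k) a with
  | zero => simp
  | tmul a b => simp
  | add s t hs ht => simp only [mul_add, map_add, hs, ht]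

lemma tensorSub_groupLike_mul {m : ℕ} [FiniteDimensional k H] (h : GroupLike k H) {w : H ⊗[k] H}
    (hw : w ∈ tensorSub (corad k H m) (corad k H m)) :
    ((h : H) ⊗ₜ[k] (h : H)) * w ∈ tensorSub (corad k H m) (corad k H m) := by
  refine tensorSub_induction
    (p := fun w => ((h : H) ⊗ₜ[k] (h : H)) * w ∈ tensorSub (corad k H m) (corad k H m)) hw
    (fun a ha b hb => ?_) (by simp)
    (fun s t hs ht => by rw [mul_add]; exact Submodule.add_mem _ hs ht)
  rw [Algebra.TensorProduct.tmul_mul_tmul]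
  exact tmul_mem_tensorSub (groupLike_mul_mem_corad h ha) (groupLike_mul_mem_corad h hb)

namespace SkewFrame

variable {ι : Type v} (D : SkewFrame k H ι)

lemma comul_groupLike_mul_x (h : GroupLike k H) (i : ι) :
    comul (R := k) ((h : H) * D.x i) = (h * D.x i) ⊗ₜ[k] (h : H) +
      ((h * D.deg i : GroupLike k H) : H) ⊗ₜ[k] (h * D.x i) := by
  have := comul_groupLike_mul h (D.comul_x i)
  rwa [mul_one] at this

lemma f_groupLike (i : ι) (h : GroupLike k H) : D.f i (h : H) = 0 := mem_augJ.1 (D.f_mem i) h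

lemma f_x (i j : ι) (h : GroupLike k H) : D.f i (h * D.x j) = D.f i (D.x j) := by
  by_cases hij : i = j
  · subst hij
    rw [D.f_mul_self]
    simpa using (D.f_mul_self i 1).symm
  · rw [D.f_mul_of_ne hij]
    simpa using (D.f_mul_of_ne hij 1).symm

lemma f_x_self (i : ι) : D.f i (D.x i) = 1 := by simpa using D.f_mul_self i 1

lemma f_x_of_ne {i j : ι} (hij : i ≠ j) : D.f i (D.x j) = 0 := by
  simpa using D.f_mul_of_ne hij 1

lemma x_mem (i : ι) : D.x i ∈ corad k H 2 := by
  intro f hf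
  rw [hitR_of_comul_eq (D.comul_x i), show f 1 = 0 from mem_augJ.1 hf 1, zero_smul, zero_add]
  exact Submodule.smul_mem _ _ (groupLike_mem_corad (D.deg i) 0)

/-- To check a linear statement on `H_1` it suffices to treat grouplike elements and translates of
frame elements. -/
lemma induction_corad_two {p : H → Prop} (group : ∀ h : GroupLike k H, p h)
    (x : ∀ (h : GroupLike k H) (i : ι), p (h * D.x i)) (zero : p 0)
    (add : ∀ a b, p a → p b → p (a + b)) (smul : ∀ (c : k) a, p a → p (c • a))
    {a : H} (ha : a ∈ corad k H 2) : p a := by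
  obtain ⟨b, hb, c, hc, rfl⟩ := Submodule.mem_sup.1 (D.corad_two_le ha)
  clear ha
  refine add _ _ ?_ ?_
  · induction hb using Submodule.span_induction with
    | mem x hx => obtain ⟨g, rfl⟩ := hx; exact group g
    | zero => exact zero
    | add x y _ _ hx hy => exact add _ _ hx hy
    | smul c x _ hx => exact smul _ _ hx
  · induction hc using Submodule.span_induction with
    | mem y hy => obtain ⟨⟨g, i⟩, rfl⟩ := hy; exact x g i
    | zero => exact zero
    | add x y _ _ hx hy => exact add _ _ hx hy
    | smul c x _ hx => exact smul _ _ hx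

/-- A functional on `H_1` is determined by its values on grouplike elements and translates of
frame elements. -/
lemma eq_on_corad_two {φ ψ : Dual k H} (h1 : ∀ h : GroupLike k H, φ h = ψ h)
    (h2 : ∀ (h : GroupLike k H) (i : ι), φ (h * D.x i) = ψ (h * D.x i)) {a : H}
    (ha : a ∈ corad k H 2) : φ a = ψ a :=
  D.induction_corad_two (p := fun a => φ a = ψ a) h1 h2 (by simp)
    (fun a b ha hb => by simp only [map_add, ha, hb]) (fun c a ha => by simp only [map_smul, ha]) ha

lemma f_groupLike_mul (i : ι) (h : GroupLike k H) {a : H} (ha : a ∈ corad k H 2) :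
    D.f i (h * a) = D.f i a :=
  D.eq_on_corad_two (φ := D.f i ∘ₗ LinearMap.mulLeft k (h : H)) (ψ := D.f i)
    (fun g => by
      rw [LinearMap.comp_apply, LinearMap.mulLeft_apply, D.f_groupLike]
      exact D.f_groupLike i (h * g))
    (fun g j => by
      rw [LinearMap.comp_apply, LinearMap.mulLeft_apply, ← mul_assoc]
      exact (D.f_x i j (h * g)).trans (D.f_x i j g).symm) ha

/-- The product of two functionals killing `H_0` kills `H_1`. -/
lemma f_hitR_f_eq_zero (i j : ι) {a : H} (ha : a ∈ corad k H 2) : D.f i (hitR (D.f j) a) = 0 := by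
  have h := ha _ (D.f_mem j)
  rw [corad_one] at h
  exact apply_eq_zero_of_mem_augJ (D.f_mem i) h

/-- Homogeneity of `f j`: convolving with a functional on the left or on the right differ by the
shift by `deg j`. -/
lemma apply_hitR_f (φ : Dual k H) (j : ι) {a : H} (ha : a ∈ corad k H 2) :
    φ (hitR (D.f j) a) =
      D.f j (hitR (φ ∘ₗ LinearMap.mulRight k (D.deg j : H)) a) := by
  refine D.eq_on_corad_two (φ := φ ∘ₗ hitR (D.f j))
    (ψ := D.f j ∘ₗ hitR (φ ∘ₗ LinearMap.mulRight k (D.deg j : H))) (fun h => ?_) (fun h i => ?_) ha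
  · simp [D.f_groupLike]
  · rw [LinearMap.comp_apply, LinearMap.comp_apply, hitR_of_comul_eq (D.comul_groupLike_mul_x h i),
      hitR_of_comul_eq (D.comul_groupLike_mul_x h i), D.f_groupLike, zero_smul, zero_add, map_smul,
      map_add, map_smul, map_smul, D.f_groupLike, smul_zero, add_zero]
    by_cases hij : j = i
    · subst hij
      simp [D.f_mul_self]
    · simp [D.f_mul_of_ne hij]

lemma comul_inv_mul_x (i : ι) :
    comul (R := k) (((D.deg i)⁻¹ : GroupLike k H) * D.x i : H) =
      (((D.deg i)⁻¹ : GroupLike k H) * D.x i : H) ⊗ₜ[k] (((D.deg i)⁻¹ : GroupLike k H) : H) +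
        (1 : H) ⊗ₜ[k] (((D.deg i)⁻¹ : GroupLike k H) * D.x i : H) := by
  have := D.comul_groupLike_mul_x (D.deg i)⁻¹ i
  rwa [inv_mul_cancel] at this

/-- An element of `H_n` moved into `H_{n-2}` by all the functionals `f i` lies in `H_{n-1}`. -/
lemma mem_corad_of_hitR_f_mem [Fintype ι] {n : ℕ} {a : H} (ha : a ∈ corad k H (n + 2))
    (h : ∀ i, hitR (D.f i) a ∈ corad k H n) : a ∈ corad k H (n + 1) := by
  intro φ hφ
  -- modulo functionals killing `H_1`, `φ` is a left combination of the `f i`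
  choose ψ hψ using fun i => exists_dual_groupLike (k := k) (C := H)
    fun g => φ (((g * (D.deg i)⁻¹ : GroupLike k H) : H) * D.x i)
  have h1 := hitR_mem_corad_sub (z := φ - ∑ i, ψ i ∘ₗ hitR (D.f i)) (m := 2) (fun b hb => by
    rw [LinearMap.sub_apply, sub_eq_zero]
    refine D.eq_on_corad_two (fun g => ?_) (fun g j => ?_) hb
    · rw [mem_augJ.1 hφ, LinearMap.sum_apply, Finset.sum_eq_zero]
      intro i _
      simp [D.f_groupLike]
    · rw [LinearMap.sum_apply, Finset.sum_eq_single j]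
      · rw [LinearMap.comp_apply, hitR_of_comul_eq (D.comul_groupLike_mul_x g j), D.f_groupLike,
          D.f_mul_self, zero_smul, zero_add, one_smul, hψ, mul_inv_cancel_right]
      · intro i _ hij
        rw [LinearMap.comp_apply, hitR_of_comul_eq (D.comul_groupLike_mul_x g j), D.f_groupLike,
          D.f_mul_of_ne hij, zero_smul, zero_smul, add_zero, map_zero]
      · simp) ha
  rw [Nat.add_sub_cancel, hitR_sub, hitR_sum] at h1
  rw [← sub_add_cancel (hitR φ a) (∑ i, hitR (ψ i ∘ₗ hitR (D.f i)) a)]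
  refine Submodule.add_mem _ h1 (Submodule.sum_mem _ fun i _ => ?_)
  rw [← hitR_hitR]
  exact hitR_mem_corad _ (h i)

/-- The braided commutator `f i * f j - r(deg j, deg i) f j * f i` in the dual algebra, where the
convolution product `f * g` is written as `f ∘ hitR g`. -/
noncomputable def commutator (r : H →ₗ[k] H →ₗ[k] k) (i j : ι) : Dual k H :=
  D.f i ∘ₗ hitR (D.f j) - r (D.deg j : H) (D.deg i) • (D.f j ∘ₗ hitR (D.f i))

lemma commutator_apply (r : H →ₗ[k] H →ₗ[k] k) (i j : ι) (a : H) : D.commutator r i j a =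
    D.f i (hitR (D.f j) a) - r (D.deg j : H) (D.deg i) * D.f j (hitR (D.f i) a) := rfl

lemma commutator_eq_zero_of_mem (r : H →ₗ[k] H →ₗ[k] k) (i j : ι) {a : H} (ha : a ∈ corad k H 2) :
    D.commutator r i j a = 0 := by
  rw [commutator_apply, D.f_hitR_f_eq_zero i j ha, D.f_hitR_f_eq_zero j i ha, mul_zero, sub_zero]

/-- The braided commutator of `f i` and `f j` is homogeneous of degree `deg i * deg j`. -/
lemma apply_hitR_commutator {r : H →ₗ[k] H →ₗ[k] k} (hr : IsCotriangularForm r)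
    (φ : Dual k H) (i j : ι) {a : H}
    (ha : a ∈ corad k H 3) : φ (hitR (D.commutator r i j) a) =
      D.commutator r i j (hitR
        (φ ∘ₗ LinearMap.mulRight k ((D.deg i * D.deg j : GroupLike k H) : H)) a) := by
  have key : ∀ i j, φ (hitR (D.f i ∘ₗ hitR (D.f j)) a) = D.f i (hitR (D.f j) (hitR
        (φ ∘ₗ LinearMap.mulRight k ((D.deg j * D.deg i : GroupLike k H) : H)) a)) := by
    intro i j
    set ψ := φ ∘ₗ LinearMap.mulRight k (D.deg i : H) with hψ
    have h1 := hitR_mem_corad_sub (z := ψ ∘ₗ hitR (D.f j) -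
      D.f j ∘ₗ hitR (ψ ∘ₗ LinearMap.mulRight k (D.deg j : H))) (m := 2)
      (fun b hb => by simp [D.apply_hitR_f ψ j hb]) ha
    rw [corad_one] at h1
    have h2 := apply_eq_zero_of_mem_augJ (D.f_mem i) h1
    rw [hitR_sub, map_sub, sub_eq_zero, ← hitR_hitR, ← hitR_hitR] at h2
    rw [← hitR_hitR, D.apply_hitR_f φ i (ha _ (D.f_mem j)), ← hψ, h2]
    have h3 : ψ ∘ₗ LinearMap.mulRight k (D.deg j : H) =
        φ ∘ₗ LinearMap.mulRight k ((D.deg j * D.deg i : GroupLike k H) : H) := by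
      ext b
      simp [hψ, mul_assoc]
    rw [h3]
  rw [commutator, hitR_sub, hitR_smul, map_sub, map_smul, key, key, groupLike_mul_comm hr
    (D.deg j) (D.deg i)]
  rfl

variable [FiniteDimensional k H] {r : H →ₗ[k] H →ₗ[k] k}

lemma f_mul_groupLike (hr : IsCotriangularForm r) (i j : ι) (h g : GroupLike k H) :
    D.f i (h * D.x j * g) = r g (D.deg j) * D.f i (D.x j) := by
  have h1 := groupLike_mul_sub_mem (m := 0) hr (y := D.x j) (g := D.deg j) (by
    rw [D.comul_x]; simp) g
  have h2 := groupLike_mul_mem_corad h h1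
  rw [zero_add, corad_one] at h2
  have h3 := apply_eq_zero_of_mem_augJ (D.f_mem i) h2
  rw [mul_sub, map_sub, sub_eq_zero, mul_smul_comm, map_smul, ← mul_assoc, ← mul_assoc,
    ← GroupLike.val_mul, D.f_x] at h3
  rw [h3, smul_eq_mul, ← mul_assoc, cotriangular_inverse hr, one_mul]

/-- Modulo `H_0`, a frame element can be moved past a grouplike element. -/
lemma x_mul_groupLike_sub_mem (hr : IsCotriangularForm r) (j : ι) (g : GroupLike k H) :
    D.x j * (g : H) - r g (D.deg j) • ((g : H) * D.x j) ∈ corad k H 1 := by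
  have h1 := groupLike_mul_sub_mem (m := 0) hr (y := D.x j) (g := D.deg j) (by
    rw [D.comul_x]; simp) g
  have h2 := Submodule.smul_mem _ (-(r (g : H) (D.deg j))) h1
  rwa [smul_sub, smul_smul, neg_mul, cotriangular_inverse hr, neg_smul, neg_smul, one_smul,
    sub_neg_eq_add, neg_add_eq_sub] at h2

/-- Frame elements are odd: an even one would be an even generator. -/
lemma deg_odd [CharZero k] (hr : IsCotriangularForm r) {N : ℕ} (hN : corad k H N = ⊤) (i : ι) :
    r (D.deg i : H) (D.deg i) = -1 := by
  rcases mul_self_eq_one_iff.1 (cotriangular_inverse hr (D.deg i) (D.deg i)) with h | h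
  · exfalso
    have h1 := groupLike_mul_sub_mem (m := 0) hr (y := D.x i) (g := D.deg i) (by
      rw [D.comul_x]; simp) (D.deg i)
    rw [h, one_smul] at h1
    refine false_of_even_generator hN (m := 0) (z := D.f i) (D.x_mem i)
      (by rw [D.comul_x]; simp) (fun u hu v hv => ?_) (D.f_mul_self i) h1
    rw [zero_add, corad_one] at hu hv
    exact apply_eq_zero_of_mem_augJ (D.f_mem i) (mul_mem_grouplikeSpan hu hv)
  · exact h

lemma f_hitR_f_x_mul_x (hr : IsCotriangularForm r) (i j l m : ι) (h : GroupLike k H) :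
    D.f i (hitR (D.f j) (h * D.x l * D.x m)) =
      D.f j (D.x m) * (r (D.deg m : H) (D.deg l) * D.f i (D.x l)) +
        D.f j (D.x l) * D.f i (D.x m) := by
  have h2 := D.f_groupLike i (h * D.deg l * D.deg m)
  rw [hitR_apply, Bialgebra.comul_mul, D.comul_groupLike_mul_x, D.comul_x]
  simp only [mul_add, add_mul, Algebra.TensorProduct.tmul_mul_tmul, map_add, sliceR_tmul, mul_one,
    map_smul, smul_eq_mul, D.f_groupLike, D.f_mul_groupLike hr, D.f_x]
  rw [← GroupLike.val_mul, h2]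
  ring

lemma commutator_mul_eq_zero (hr : IsCotriangularForm r) (i j : ι) {u v : H}
    (hu : u ∈ corad k H 2) (hv : v ∈ corad k H 2) : D.commutator r i j (u * v) = 0 := by
  have hxx : ∀ (h : GroupLike k H) (l m : ι), D.commutator r i j (h * D.x l * D.x m) = 0 := by
    intro h l m
    rw [commutator_apply, D.f_hitR_f_x_mul_x hr, D.f_hitR_f_x_mul_x hr]
    have h1 : D.f j (D.x m) * (r (D.deg m : H) (D.deg l) * D.f i (D.x l)) =
        r (D.deg j : H) (D.deg i) * (D.f j (D.x m) * D.f i (D.x l)) := by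
      by_cases hj : j = m
      · by_cases hi : i = l
        · subst hj; subst hi; ring
        · rw [D.f_x_of_ne hi]; ring
      · rw [D.f_x_of_ne hj]; ring
    have h2 : r (D.deg j : H) (D.deg i) * (D.f i (D.x m) * (r (D.deg m : H) (D.deg l) *
        D.f j (D.x l))) = D.f j (D.x l) * D.f i (D.x m) := by
      by_cases hj : j = l
      · by_cases hi : i = m
        · subst hj; subst hi
          linear_combination (D.f j (D.x j) * D.f i (D.x i)) *
            cotriangular_inverse hr (D.deg j) (D.deg i)
        · rw [D.f_x_of_ne hi]; ring
      · rw [D.f_x_of_ne hj]; ring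
    linear_combination h1 - h2
  refine D.induction_corad_two (p := fun u => D.commutator r i j (u * v) = 0)
    (fun h => D.commutator_eq_zero_of_mem r i j (groupLike_mul_mem_corad h hv)) (fun h l => ?_)
    (by simp) (fun a b ha hb => by rw [add_mul, map_add, ha, hb, add_zero])
    (fun c a ha => by rw [smul_mul_assoc, map_smul, ha, smul_zero]) hu
  refine D.induction_corad_two (p := fun v => D.commutator r i j (h * D.x l * v) = 0)
    (fun g => D.commutator_eq_zero_of_mem r i j
      (mul_groupLike_mem_corad g (groupLike_mul_mem_corad h (D.x_mem l)))) (fun g m => ?_)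
    (by simp) (fun a b ha hb => by rw [mul_add, map_add, ha, hb, add_zero])
    (fun c a ha => by rw [mul_smul_comm, map_smul, ha, smul_zero]) hv
  -- move the grouplike factor between the two frame elements to the left
  have h1 := mul_mem_corad_right (groupLike_mul_mem_corad h (D.x_mul_groupLike_sub_mem hr l g))
    (D.x_mem m)
  have h2 := D.commutator_eq_zero_of_mem r i j h1
  rw [mul_sub, sub_mul, map_sub, sub_eq_zero] at h2
  rw [← mul_assoc, mul_assoc (h : H), h2, mul_smul_comm, smul_mul_assoc, map_smul, ← mul_assoc,
    ← GroupLike.val_mul, hxx, smul_zero]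

lemma commutator_groupLike_mul (i j : ι) (h : GroupLike k H) {a : H} (ha : a ∈ corad k H 3) :
    D.commutator r i j (h * a) = D.commutator r i j a := by
  have key : ∀ i j, D.f i (hitR (D.f j) (h * a)) = D.f i (hitR (D.f j) a) := by
    intro i j
    have h1 := hitR_mem_corad_sub (z := D.f j ∘ₗ LinearMap.mulLeft k (h : H) - D.f j) (m := 2)
      (fun b hb => by simp [D.f_groupLike_mul j h hb]) ha
    have h2 := groupLike_mul_mem_corad h h1
    rw [corad_one] at h2
    have h3 := apply_eq_zero_of_mem_augJ (D.f_mem i) h2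
    rw [hitR_sub, mul_sub, map_sub, sub_eq_zero] at h3
    rw [hitR_groupLike_mul, h3, D.f_groupLike_mul i h (ha _ (D.f_mem j))]
  rw [commutator_apply, commutator_apply, key, key]

/-- The dual functionals commute up to a scalar modulo functionals killing `H_2`: otherwise their
braided commutator would detect a generator of even degree `deg i * deg j` in `H_2`. -/
lemma commutator_eq_zero [CharZero k] (hr : IsCotriangularForm r) {N : ℕ}
    (hN : corad k H N = ⊤) (i j : ι) {a : H} (ha : a ∈ corad k H 3) :
    D.commutator r i j a = 0 := by
  cases nonempty_fintype (GroupLike k H)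
  set z := D.commutator r i j with hz
  have hz2 : ∀ b ∈ corad k H 2, z b = 0 := fun b hb => D.commutator_eq_zero_of_mem r i j hb
  by_contra hza
  -- some bihomogeneous component is detected
  obtain ⟨h, g, hy⟩ : ∃ h g : GroupLike k H, z (component h g a) ≠ 0 := by
    by_contra! hcon
    have h1 := hz2 _ (sub_sum_component_mem (n := 2) ha)
    rw [map_sub, map_sum, sub_eq_zero] at h1
    refine hza (h1.trans (Finset.sum_eq_zero fun h _ => ?_))
    rw [map_sum]
    exact Finset.sum_eq_zero fun g _ => hcon h g
  have hcomp := component_mem_corad h g ha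
  have hw := comul_component (n := 1) h g ha
  set y' := component h g a
  -- normalise the component to right degree `1` and value `1`
  set y : H := (z y')⁻¹ • ((g⁻¹ : GroupLike k H) * y') with hydef
  have hy3 : y ∈ corad k H 3 := Submodule.smul_mem _ _ (groupLike_mul_mem_corad g⁻¹ hcomp)
  have hzy : z y = 1 := by
    rw [hydef, map_smul, hz, D.commutator_groupLike_mul i j g⁻¹ hcomp, ← hz, smul_eq_mul,
      inv_mul_cancel₀ hy]
  have hzhy : ∀ l : GroupLike k H, z (l * y) = 1 := fun l => by
    rw [hz, D.commutator_groupLike_mul i j l hy3, ← hz, hzy]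
  have hcy : comul (R := k) y - y ⊗ₜ[k] (1 : H) - ((g⁻¹ * h : GroupLike k H) : H) ⊗ₜ[k] y ∈
      tensorSub (corad k H 2) (corad k H 2) := by
    have h1 := Submodule.smul_mem _ (z y')⁻¹ (tensorSub_groupLike_mul g⁻¹ hw)
    convert h1 using 1
    have h2 : ((g⁻¹ : GroupLike k H) : H) * g = 1 := by
      rw [← GroupLike.val_mul, inv_mul_cancel, GroupLike.val_one]
    rw [hydef, map_smul, Bialgebra.comul_mul, (g⁻¹).2.comul_eq_tmul_self, mul_sub, mul_sub,
      Algebra.TensorProduct.tmul_mul_tmul, Algebra.TensorProduct.tmul_mul_tmul, h2, smul_sub,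
      smul_sub, TensorProduct.smul_tmul', TensorProduct.tmul_smul, GroupLike.val_mul]
  set γ : GroupLike k H := g⁻¹ * h
  set w := comul (R := k) y - y ⊗ₜ[k] (1 : H) - (γ : H) ⊗ₜ[k] y with hwdef
  have hcy' : comul (R := k) y = y ⊗ₜ[k] (1 : H) + (γ : H) ⊗ₜ[k] y + w := by rw [hwdef]; abel
  have hz1 : ∀ l : GroupLike k H, z l = 0 := fun l => hz2 _ (groupLike_mem_corad l 1)
  have hwR : sliceR z w = 0 := tensorSub_induction (p := fun w => sliceR z w = 0) hcy
    (fun u _ v hv => by rw [sliceR_tmul, hz2 v hv, zero_smul]) (by simp)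
    (fun s t hs ht => by rw [map_add, hs, ht, add_zero])
  have hwL : sliceL z w = 0 := tensorSub_induction (p := fun w => sliceL z w = 0) hcy
    (fun u hu v _ => by rw [sliceL_tmul, hz2 u hu, zero_smul]) (by simp)
    (fun s t hs ht => by rw [map_add, hs, ht, add_zero])
  have hR : hitR z y = (γ : H) := by
    rw [hitR_apply, hcy', map_add, map_add, hwR, sliceR_tmul, sliceR_tmul,
      show z 1 = 0 from hz1 1, hzy]
    simp
  have hL : hitL z y = 1 := by
    rw [hitL_apply, hcy', map_add, map_add, hwL, sliceL_tmul, sliceL_tmul, hz1, hzy]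
    simp
  -- the commutator is homogeneous of degree `deg i * deg j`
  have hdeg : D.deg i * D.deg j = γ := by
    have h1 := D.apply_hitR_commutator hr (dualAt γ) i j hy3
    rw [← hz, hR, dualAt_self, apply_hitR, hL, LinearMap.comp_apply, LinearMap.mulRight_apply,
      one_mul, dualAt_apply] at h1
    by_contra hne
    rw [if_neg hne] at h1
    exact one_ne_zero h1
  have heven : r (γ : H) γ = 1 := by
    have h1 : r ((D.deg i * D.deg j : GroupLike k H) : H) (D.deg i * D.deg j : GroupLike k H) =
        r ((D.deg i : H) * D.deg j) (D.deg i) * r ((D.deg i : H) * D.deg j) (D.deg j) :=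
      cotriangular_mul_right hr (D.deg i * D.deg j) _ _
    rw [← hdeg, h1, cotriangular_mul_left hr, cotriangular_mul_left hr, D.deg_odd hr hN,
      D.deg_odd hr hN]
    linear_combination cotriangular_inverse hr (D.deg i) (D.deg j)
  have hcomm := groupLike_mul_sub_mem hr hcy γ
  rw [heven, one_smul] at hcomm
  exact false_of_even_generator hN (m := 1) hy3 hcy
    (fun u hu v hv => D.commutator_mul_eq_zero hr i j hu hv) hzhy hcomm

variable [Fintype ι]

/-- The Euler operator `a ↦ ∑ᵢ (f i ⇀ a) (deg i)⁻¹ x i`, which multiplies the `n`-th layer of the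
coradical filtration by `n`. -/
noncomputable def euler (a : H) : H :=
  ∑ i, hitR (D.f i) a * (((D.deg i)⁻¹ : GroupLike k H) * D.x i)

lemma euler_mem {n : ℕ} {a : H} (ha : a ∈ corad k H (n + 1)) : D.euler a ∈ corad k H (n + 1) :=
  Submodule.sum_mem _ fun i _ => mul_mem_corad_right (ha _ (D.f_mem i))
    (groupLike_mul_mem_corad _ (D.x_mem i))

/-- The functionals `f j` act on the image of the Euler operator as in an exterior algebra. -/
lemma hitR_f_euler_sub_mem [CharZero k] (hr : IsCotriangularForm r) {N : ℕ}
    (hN : corad k H N = ⊤) (j : ι) {n : ℕ} {a : H} (ha : a ∈ corad k H (n + 2)) :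
    hitR (D.f j) (D.euler a) - (D.euler (hitR (D.f j) a) + hitR (D.f j) a) ∈ corad k H n := by
  classical
  have hterm : ∀ i, hitR (D.f j) (hitR (D.f i) a * (((D.deg i)⁻¹ : GroupLike k H) * D.x i)) -
      (hitR (D.f i) (hitR (D.f j) a) * (((D.deg i)⁻¹ : GroupLike k H) * D.x i) +
        if j = i then hitR (D.f j) a else 0) ∈ corad k H n := by
    intro i
    set b := hitR (D.f i) a with hb
    have hbm : b ∈ corad k H (n + 1) := ha _ (D.f_mem i)
    set y : H := ((D.deg i)⁻¹ : GroupLike k H) * D.x i with hy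
    have hy2 : y ∈ corad k H 2 := groupLike_mul_mem_corad _ (D.x_mem i)
    set gi : GroupLike k H := (D.deg i)⁻¹ with hgi
    have hprod : hitR (D.f j) (b * y) = hitR (D.f j ∘ₗ LinearMap.mulRight k (gi : H)) b * y +
        hitR (D.f j ∘ₗ LinearMap.mulRight k y) b := by
      rw [hitR_apply, Bialgebra.comul_mul, D.comul_inv_mul_x, mul_add, map_add, sliceR_mul_tmul,
        sliceR_mul_tmul, mul_one]
      rfl
    have hχ : r (gi : H) (D.deg j) = r (D.deg j : H) (D.deg i) := by
      have h1 := cotriangular_inverse hr (D.deg i) (D.deg j)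
      have h2 := cotriangular_mul_left hr (gi : H) (D.deg i) (D.deg j)
      rw [← GroupLike.val_mul, hgi, inv_mul_cancel, GroupLike.val_one, cotriangular_one_left hr,
        ← hgi] at h2
      linear_combination (-(r (gi : H) (D.deg j))) * h1 - r (D.deg j : H) (D.deg i) * h2
    -- first term: `f j (· g)` is a multiple of `f j` on `H_1`
    have h1 := hitR_mem_corad_sub (m := 2) (z := D.f j ∘ₗ LinearMap.mulRight k (gi : H) -
      r (D.deg j : H) (D.deg i) • D.f j) (fun c hc => by
        rw [LinearMap.sub_apply, sub_eq_zero]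
        refine D.eq_on_corad_two (fun g => ?_) (fun g l => ?_) hc
        · rw [LinearMap.smul_apply, D.f_groupLike, smul_zero]
          exact D.f_groupLike j (g * gi)
        · rw [LinearMap.comp_apply, LinearMap.mulRight_apply, D.f_mul_groupLike hr,
            LinearMap.smul_apply, D.f_x, smul_eq_mul]
          by_cases hjl : j = l
          · rw [← hjl, hχ]
          · rw [D.f_x_of_ne hjl, mul_zero, mul_zero]) hbm
    have h1' : (hitR (D.f j ∘ₗ LinearMap.mulRight k (gi : H)) b -
        r (D.deg j : H) (D.deg i) • hitR (D.f j) b) * y ∈ corad k H n := by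
      rw [hitR_sub, hitR_smul] at h1
      cases n with
      | zero =>
        rw [show 0 + 1 - 2 = 0 from rfl, mem_corad_zero] at h1
        rw [h1, zero_mul]
        exact Submodule.zero_mem _
      | succ n => exact mul_mem_corad_right (n := 1) h1 hy2
    -- second term: `f j (· y)` is constant on grouplike elements
    have h2 := hbm (D.f j ∘ₗ LinearMap.mulRight k y - (if j = i then (1 : k) else 0) • counit)
      (mem_augJ.2 fun g => by
        rw [LinearMap.sub_apply, LinearMap.comp_apply, LinearMap.mulRight_apply, hy, ← mul_assoc,
          ← GroupLike.val_mul, D.f_x, LinearMap.smul_apply, g.2.counit_eq_one]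
        split_ifs with hji
        · rw [hji, D.f_x_self]; simp
        · rw [D.f_x_of_ne hji]; simp)
    rw [hitR_sub, hitR_smul, hitR_counit] at h2
    -- exchange of `f i` and `f j`
    have h3 := hitR_mem_corad_sub (fun c hc => D.commutator_eq_zero hr hN i j hc) ha
    have h3' : (hitR (D.f i) (hitR (D.f j) a) - r (D.deg j : H) (D.deg i) • hitR (D.f j) b) * y ∈
        corad k H n := by
      rw [commutator, hitR_sub, hitR_smul, ← hitR_hitR, ← hitR_hitR] at h3
      cases n with
      | zero =>
        rw [show 0 + 2 - 3 = 0 from rfl, mem_corad_zero] at h3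
        rw [hb, h3, zero_mul]
        exact Submodule.zero_mem _
      | succ n => exact mul_mem_corad_right (n := 1) h3 hy2
    have := Submodule.add_mem _ (Submodule.sub_mem _ h1' h3') h2
    convert this using 1
    have hite : (if j = i then hitR (D.f j) a else 0) = (if j = i then (1 : k) else 0) • b := by
      split_ifs with hji
      · rw [one_smul, hb, hji]
      · rw [zero_smul]
    rw [hprod, hite, sub_mul, sub_mul]
    abel
  have hsum := Submodule.sum_mem _ fun i (_ : i ∈ Finset.univ) => hterm i
  rw [Finset.sum_sub_distrib, Finset.sum_add_distrib, Finset.sum_ite_eq, ← map_sum] at hsum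
  simpa [euler] using hsum

/-- The Euler operator acts on `H_n / H_{n-1}` as multiplication by `n`. -/
lemma euler_sub_smul_mem [CharZero k] (hr : IsCotriangularForm r) {N : ℕ}
    (hN : corad k H N = ⊤) {n : ℕ} {a : H} (ha : a ∈ corad k H (n + 1)) :
    D.euler a - (n : k) • a ∈ corad k H n := by
  induction n generalizing a with
  | zero =>
    have : ∀ i, hitR (D.f i) a = 0 := fun i => mem_corad_zero.1 (ha _ (D.f_mem i))
    simp [euler, this]
  | succ n ih =>
    refine D.mem_corad_of_hitR_f_mem
      (Submodule.sub_mem _ (D.euler_mem ha) (Submodule.smul_mem _ _ ha)) fun j => ?_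
    have h1 := D.hitR_f_euler_sub_mem hr hN j ha
    have h2 := ih (ha _ (D.f_mem j))
    have := Submodule.add_mem _ h1 h2
    convert this using 1
    rw [map_sub, map_smul]
    push_cast
    rw [add_smul, one_smul]
    abel

end SkewFrame

end Commutation

/-- Over a field of characteristic zero, every term of the coradical filtration lies in the
subalgebra generated by the grouplike and the skew-primitive elements. -/
lemma corad_le_adjoin {k : Type u} {H : Type v} [Field k] [CharZero k] [Ring H] [HopfAlgebra k H]
    [FiniteDimensional k H] {r : H →ₗ[k] H →ₗ[k] k} (hr : IsCotriangularForm r) {N : ℕ}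
    (hN : corad k H N = ⊤) (n : ℕ) : corad k H (n + 1) ≤ Subalgebra.toSubmodule
      (Algebra.adjoin k {x : H | IsGroupLikeElem k x ∨ IsSkewPrimitiveElem k x}) := by
  obtain ⟨ι, _, ⟨D⟩⟩ := exists_skewFrame k H
  induction n with
  | zero =>
    rw [zero_add, corad_one]
    refine Submodule.span_le.2 ?_
    rintro _ ⟨g, rfl⟩
    exact Algebra.subset_adjoin (Or.inl g.2)
  | succ n ih =>
    intro a ha
    have h1 := ih (D.euler_sub_smul_mem hr hN ha)
    have h2 : D.euler a ∈ Subalgebra.toSubmodule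
        (Algebra.adjoin k {x : H | IsGroupLikeElem k x ∨ IsSkewPrimitiveElem k x}) := by
      refine Submodule.sum_mem _ fun i _ => ?_
      refine Subalgebra.mul_mem _ (ih (ha _ (D.f_mem i)))
        (Subalgebra.mul_mem _ (Algebra.subset_adjoin (Or.inl ((D.deg i)⁻¹).2))
          (Algebra.subset_adjoin (Or.inr ⟨1, D.deg i, .one, (D.deg i).2, D.comul_x i⟩)))
    have h3 := Submodule.sub_mem _ h2 h1
    rw [sub_sub_cancel] at h3
    exact (Submodule.smul_mem_iff _ (by exact_mod_cast Nat.succ_ne_zero n)).1 h3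

end PointedHopf

theorem theorem6p1 (H : Type v) [Ring H] [HopfAlgebra ℂ H] [FiniteDimensional ℂ H]
    (hpointed : IsPointedCoalgebra ℂ H) (hcotriangular : IsCotriangular ℂ H) :
    Algebra.adjoin ℂ {x : H | IsGroupLikeElem ℂ x ∨ IsSkewPrimitiveElem ℂ x} = ⊤ := by
  obtain ⟨r, hr⟩ := hcotriangular
  obtain ⟨N, hN⟩ := PointedHopf.exists_corad_eq_top hpointed
  refine Algebra.eq_top_iff.2 fun a => PointedHopf.corad_le_adjoin hr hN N ?_
  exact PointedHopf.corad_mono (Nat.le_succ N) (hN ▸ Submodule.mem_top)
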